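/- Let $p,q,r\in\{1,2,3,\dots\}\cup\{\infty\}$, with the conventions that every positive integer divides $\infty$ and that relations $W^\infty=1$ are ignored. Consider the triangle group $$\Delta(p,q,r)=\langle X,Y,Z\mid X^p=Y^q=Z^r=XYZ=1\rangle$$ and the extended triangle group $$\Delta[p,q,r]=\langle R_0,R_1,R_2\mid R_0^2=R_1^2=R_2^2=(R_1R_2)^p=(R_2R_0)^q=(R_0R_1)^r=1\rangle .$$ A group $\Gamma$ has the countable automorphism realisation property if every countable (finite or countably infinite) group $A$ is isomorphic to $N_\Gamma(M)/M$ for some subgroup $M\le\Gamma$. A category $\mathfrak C$ equipped with a notion of connected object has the countable automorphism realisation property if every countable group is isomorphic to $\mathrm{Aut}_{\mathfrak C}(\mathcal O)$ for some connected object $\mathcal O$ of $\mathfrak C$. A permutational category with parent group $\Gamma$ is a category equivalent to the category of permutation representations of $\Gamma$ on sets, with $\Gamma$-equivariant functions as morphisms; its connected objects are those corresponding to transitive representations on non-empty sets. An oriented hypermap of type $(p,q,r)$ is a set $\Omega$ with permutations $x,y,z$ satisfying $xyz=x^p=y^q=z^r=1$; a hypermap of type $(p,q,r)$ is a set $\Omega$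 with permutations $r_0,r_1,r_2$ satisfying $r_i^2=(r_1r_2)^p=(r_2r_0)^q=(r_0r_1)^r=1$. Morphisms in these categories are the functions commuting with the given permutations, and an object is connected if $\Omega$ is non-empty and the group generated by the given permutations is transitive on $\Omega$. **Proposition.** Suppose that one of $p,q,r$ is even, another is divisible by $3$, and the third is at least $7$. Then the following all have the countable automorphism realisation property: 1. the groups $\Delta(p,q,r)$ and $\Delta[p,q,r]$; 2. the category of oriented hypermaps of type $(p,q,r)$ and the category of all hypermaps of type $(p,q,r)$; 3. every permutational category whose parent group is $\Delta(p,q,r)$ or $\Delta[p,q,r]$. -/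

import Mathlib

open CategoryTheory

universe u v w w'

namespace Realisation

/-! ### Triangle groups and extended triangle groups

Periods are elements of `ℕ∞`; a relation `W ^ ∞ = 1` is ignored. -/

/-- The relator `g ^ n` if `n` is finite, and no relator if `n = ∞`. -/
def powRel {G : Type*} [Monoid G] (g : G) (n : ℕ∞) : Set G :=
  {t | ∃ k : ℕ, n = (k : ℕ∞) ∧ t = g ^ k}

/-- The standard generators of a triangle group. -/
inductive TriGen : Type
  | X | Y | Z

/-- The relators `X ^ p`, `Y ^ q`, `Z ^ r`, `X * Y * Z`. -/
def triangleRels (p q r : ℕ∞) : Set (FreeGroup TriGen) :=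
  powRel (FreeGroup.of TriGen.X) p ∪ powRel (FreeGroup.of TriGen.Y) q ∪
    powRel (FreeGroup.of TriGen.Z) r ∪
    {FreeGroup.of TriGen.X * FreeGroup.of TriGen.Y * FreeGroup.of TriGen.Z}

/-- The triangle group `Δ(p,q,r) = ⟨X, Y, Z ∣ X^p = Y^q = Z^r = XYZ = 1⟩`. -/
abbrev TriangleGroup (p q r : ℕ∞) : Type := PresentedGroup (triangleRels p q r)

/-- The standard generators (reflections) of an extended triangle group. -/
inductive RefGen : Type
  | R₀ | R₁ | R₂

/-- The relators `R_i ^ 2`, `(R₁R₂) ^ p`, `(R₂R₀) ^ q`, `(R₀R₁) ^ r`. -/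
def extTriangleRels (p q r : ℕ∞) : Set (FreeGroup RefGen) :=
  Set.range (fun i : RefGen => FreeGroup.of i ^ 2) ∪
    powRel (FreeGroup.of RefGen.R₁ * FreeGroup.of RefGen.R₂) p ∪
    powRel (FreeGroup.of RefGen.R₂ * FreeGroup.of RefGen.R₀) q ∪
    powRel (FreeGroup.of RefGen.R₀ * FreeGroup.of RefGen.R₁) r

/-- The extended triangle group
`Δ[p,q,r] = ⟨R₀, R₁, R₂ ∣ R_i^2 = (R₁R₂)^p = (R₂R₀)^q = (R₀R₁)^r = 1⟩`. -/
abbrev ExtTriangleGroup (p q r : ℕ∞) : Type := PresentedGroup (extTriangleRels p q r)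

/-! ### The countable automorphism realisation property -/

/-- A group `Γ` has the countable automorphism realisation property if every countable group is
isomorphic to `N_Γ(M) / M` for some subgroup `M` of `Γ`. -/
def GroupCARP (Γ : Type v) [Group Γ] : Prop :=
  ∀ (A : Type u) [Group A] [Countable A], ∃ M : Subgroup Γ,
    Nonempty (A ≃* (Subgroup.normalizer (M : Set Γ) ⧸
      M.subgroupOf (Subgroup.normalizer (M : Set Γ))))

/-- A category `C`, with a given notion of connected object, has the countable automorphism
realisation property if every countable group is isomorphic to the automorphism group of some
connected object of `C`. -/
def CategoryCARP (C : Type v) [Category.{w} C] (IsConn : C → Prop) : Prop :=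
  ∀ (A : Type u) [Group A] [Countable A], ∃ O : C, IsConn O ∧ Nonempty (A ≃* Aut O)

/-- A permutation representation of `Γ` (an object of the category `Action (Type w) Γ` of sets
with a `Γ`-action and `Γ`-equivariant functions) is transitive. -/
def IsTransitiveRep {Γ : Type v} [Group Γ] (Ω : Action (Type w) Γ) : Prop :=
  Nonempty Ω.V ∧ ∀ a b : Ω.V, ∃ g : Γ, Ω.ρ g a = b

/-! ### Hypermaps of a given type

Hypermaps are given in the usual combinatorial way, by their monodromy permutations. -/

/-- `g ^ n = 1`, a condition that is void if `n = ∞`. -/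
def PowEqOne {G : Type*} [Monoid G] (g : G) (n : ℕ∞) : Prop :=
  ∀ k : ℕ, n = (k : ℕ∞) → g ^ k = 1

/-- An oriented hypermap of type `(p,q,r)`: a set of edges of the associated bipartite map, with
the permutations `x`, `y`, `z` rotating them around the black vertices, white vertices and faces,
whose valencies divide `p`, `q`, `r` respectively. -/
structure OrientedHypermap (p q r : ℕ∞) : Type (u + 1) where
  Ω : Type u
  x : Equiv.Perm Ω
  y : Equiv.Perm Ω
  z : Equiv.Perm Ω
  xyz : x * y * z = 1
  x_pow : PowEqOne x p
  y_pow : PowEqOne y q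
  z_pow : PowEqOne z r

namespace OrientedHypermap

variable {p q r : ℕ∞}

/-- A morphism of oriented hypermaps: a function commuting with the monodromy permutations. -/
@[ext]
structure Hom (H K : OrientedHypermap.{u} p q r) : Type u where
  toFun : H.Ω → K.Ω
  map_x : ∀ a, toFun (H.x a) = K.x (toFun a)
  map_y : ∀ a, toFun (H.y a) = K.y (toFun a)
  map_z : ∀ a, toFun (H.z a) = K.z (toFun a)

instance : Category (OrientedHypermap.{u} p q r) where
  Hom H K := Hom H K
  id H := ⟨id, fun _ => rfl, fun _ => rfl, fun _ => rfl⟩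
  comp f g := ⟨g.toFun ∘ f.toFun, fun a => by simp [f.map_x, g.map_x],
    fun a => by simp [f.map_y, g.map_y], fun a => by simp [f.map_z, g.map_z]⟩

/-- The monodromy group of an oriented hypermap. -/
def monodromyGroup (H : OrientedHypermap.{u} p q r) : Subgroup (Equiv.Perm H.Ω) :=
  Subgroup.closure {H.x, H.y, H.z}

/-- An oriented hypermap is connected if its monodromy group is transitive. -/
def IsConn (H : OrientedHypermap.{u} p q r) : Prop :=
  Nonempty H.Ω ∧ MulAction.IsPretransitive H.monodromyGroup H.Ω

end OrientedHypermap

/-- A hypermap of type `(p,q,r)`, possibly non-orientable or with boundary: a set of flags with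
permutations `r₀`, `r₁`, `r₂` of order dividing `2` (fixed points are allowed) satisfying the type
relations. -/
structure Hypermap (p q r : ℕ∞) : Type (u + 1) where
  Ω : Type u
  r₀ : Equiv.Perm Ω
  r₁ : Equiv.Perm Ω
  r₂ : Equiv.Perm Ω
  r₀_sq : r₀ ^ 2 = 1
  r₁_sq : r₁ ^ 2 = 1
  r₂_sq : r₂ ^ 2 = 1
  pow_p : PowEqOne (r₁ * r₂) p
  pow_q : PowEqOne (r₂ * r₀) q
  pow_r : PowEqOne (r₀ * r₁) r

namespace Hypermap

variable {p q r : ℕ∞}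

/-- A morphism of hypermaps: a function commuting with the monodromy permutations. -/
@[ext]
structure Hom (H K : Hypermap.{u} p q r) : Type u where
  toFun : H.Ω → K.Ω
  map_r₀ : ∀ a, toFun (H.r₀ a) = K.r₀ (toFun a)
  map_r₁ : ∀ a, toFun (H.r₁ a) = K.r₁ (toFun a)
  map_r₂ : ∀ a, toFun (H.r₂ a) = K.r₂ (toFun a)

instance : Category (Hypermap.{u} p q r) where
  Hom H K := Hom H K
  id H := ⟨id, fun _ => rfl, fun _ => rfl, fun _ => rfl⟩
  comp f g := ⟨g.toFun ∘ f.toFun, fun a => by simp [f.map_r₀, g.map_r₀],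
    fun a => by simp [f.map_r₁, g.map_r₁], fun a => by simp [f.map_r₂, g.map_r₂]⟩

/-- The monodromy group of a hypermap. -/
def monodromyGroup (H : Hypermap.{u} p q r) : Subgroup (Equiv.Perm H.Ω) :=
  Subgroup.closure {H.r₀, H.r₁, H.r₂}

/-- A hypermap is connected if its monodromy group is transitive. -/
def IsConn (H : Hypermap.{u} p q r) : Prop :=
  Nonempty H.Ω ∧ MulAction.IsPretransitive H.monodromyGroup H.Ω

end Hypermap

/-- Every permutational category with parent group `Γ`, that is, every category `C` with an
equivalence to the category of permutation representations of `Γ`, has the countable automorphism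
realisation property, the connected objects being those that correspond to transitive
representations. -/
def PermutationalCARP (Γ : Type) [Group Γ] : Prop :=
  ∀ (C : Type v) [Category.{w} C] (e : C ≌ Action (Type w') Γ),
    CategoryCARP.{u} C (fun O => IsTransitiveRep (e.functor.obj O))

end Realisation

namespace Realisation

/-! ### Realising groups by permutations -/

/-! Suppose a group acts on a set, `A` acts on the same set by permutations commuting with it and
freely at a base point, this `A`-orbit lies in one orbit of the group, and the base stabiliser `M`
fixes no point outside that `A`-orbit. An element normalises `M` exactly when it sends the base
point into the `A`-orbit, so `N(M)/M` is `A`. In `Realises` the motion along the orbit and the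
rigidity come from a small group `H`, and commutation holds for a large group `K`. Every group
acting with image between the two then realises `A`, so one set of permutations serves both the
triangle group (rotations) and the extended one (reflections).

The divisibility conditions reduce everything to permutations of type `(2,3,n)` with `n ≥ 7`, where
`n` is the third period, or `7` if that is infinite. Start from a finite trivalent plane map whose
outer face has length `n`: a caterpillar, whose length is adjusted in steps of three and whose
residue modulo three is settled by the choice of the end `t`. Its coverings may branch at a vertex
of valency one (monodromy `d`, of order dividing three), at two free edges (involutions `c₁`, `c₂`)
and at the end `t` (monodromy `e`, of order dividing two or three). The relation `e c₂ c₁ d = 1`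
prevents branching over the outer face, so face lengths still divide `n`; see `facePerm_pow`. What
remains is to choose `d`, `e` and an involution `c₁` inverting `de`, for `c₂ = (de)⁻¹ c₁` is then an
involution.

The sheets are `A × B`, with `A` acting by left translation. On `B` an infinite chain of finite
`⟨d,e⟩`-orbits is joined by `c₁`, with exactly one common fixed point of `d` and `c₁`; voltages on
`c₁` make the closed walks from that point realise a sequence enumerating `A`, which is where
countability enters. Local patterns in the map (`eq_of_fixed`) show that the base stabiliser
recognises the base orbit, even in the mirror copy added to obtain reflections.

For categories, `N(M)/M` is identified with the automorphism group of the transitive representation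
on `Γ ⧸ M`. -/

/-- `K` is a group of permutations of `T` commuting with an action of `A`, and the points fixed by
all elements of `H` which fix some base point are exactly those of its `A`-orbit, which is regular
and contained in its `H`-orbit. -/
def Realises (A : Type u) [Group A] {T : Type v} (H K : Subgroup (Equiv.Perm T)) : Prop :=
  ∃ (α : A →* Equiv.Perm T) (t₀ : T), (∀ a, α a t₀ = t₀ → a = 1) ∧
    (∀ a, ∀ h ∈ K, ∀ t, α a (h t) = h (α a t)) ∧ (∀ a, ∃ h ∈ H, h t₀ = α a t₀) ∧
    ∀ t, (∀ h ∈ H, h t₀ = t₀ → h t = t) → ∃ a, t = α a t₀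

/-- Take `M` to be the stabiliser of the base point. If `n` normalises `M`, then `M` fixes `n t₀`,
so rigidity puts it in the `A`-orbit; conversely, points of that orbit have the same stabiliser as
`t₀` because `A` commutes with the action. -/
theorem Realises.exists_subgroup {A : Type u} [Group A] {T : Type v}
    {H K : Subgroup (Equiv.Perm T)} (h : Realises A H K) {Γ : Type w}
    [Group Γ] (φ : Γ →* Equiv.Perm T) (hH : H ≤ φ.range) (hK : φ.range ≤ K) :
    ∃ M : Subgroup Γ, Nonempty (A ≃* (Subgroup.normalizer (M : Set Γ) ⧸
      M.subgroupOf (Subgroup.normalizer (M : Set Γ)))) := by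
  obtain ⟨α, t₀, hfree, hcomm, htrans, hrig⟩ := h
  have hcomm' : ∀ a g t, α a (φ g t) = φ g (α a t) := fun a g t =>
    hcomm a (φ g) (hK ⟨g, rfl⟩) t
  let M : Subgroup Γ :=
    { carrier := {g | φ g t₀ = t₀}
      one_mem' := by simp
      mul_mem' := by
        intro a b ha hb
        simp only [Set.mem_ofPred_eq] at ha hb ⊢
        rw [map_mul, Equiv.Perm.mul_apply, hb, ha]
      inv_mem' := by
        intro a ha
        simp only [Set.mem_ofPred_eq] at ha ⊢
        rw [map_inv, Equiv.Perm.inv_eq_iff_eq, ha] }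
  have hM : ∀ g, g ∈ M ↔ φ g t₀ = t₀ := fun g => Iff.rfl
  have hN : ∀ n : Subgroup.normalizer (M : Set Γ), ∃ a, φ n t₀ = α a t₀ := by
    rintro ⟨n, hn⟩
    apply hrig
    intro h hh hht
    obtain ⟨g, rfl⟩ := hH hh
    have h1 : n⁻¹ * g * n ∈ M := by
      have := (Subgroup.mem_normalizer_iff.1 (inv_mem hn) g).1 hht
      simpa using this
    rw [hM, map_mul, map_mul, Equiv.Perm.mul_apply, Equiv.Perm.mul_apply, map_inv,
      Equiv.Perm.inv_eq_iff_eq] at h1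
    exact h1
  have hinj : ∀ a b, α a t₀ = α b t₀ → a = b := by
    intro a b hab
    have : α (b⁻¹ * a) t₀ = t₀ := by
      rw [map_mul, Equiv.Perm.mul_apply, hab, ← Equiv.Perm.mul_apply, ← map_mul, inv_mul_cancel, map_one, Equiv.Perm.one_apply]
    exact (inv_mul_eq_one.1 (hfree _ this)).symm
  choose f hf using hN
  -- The assignment `n ↦ f n` reverses products, since `A` commutes with the action; inverting makes
  -- it a homomorphism.
  let ψ : Subgroup.normalizer (M : Set Γ) →* A := MonoidHom.mk' (fun n => (f n)⁻¹) (by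
    intro m n
    rw [← mul_inv_rev, inv_inj]
    apply hinj
    rw [← hf, map_mul, Equiv.Perm.mul_apply, ← hf m, hcomm', ← hf n, Subgroup.coe_mul,
      map_mul, Equiv.Perm.mul_apply])
  have hψ : Function.Surjective ψ := by
    intro a
    obtain ⟨h, hh, hht⟩ := htrans a⁻¹
    obtain ⟨g, rfl⟩ := hH hh
    have hg : g ∈ Subgroup.normalizer (M : Set Γ) := by
      rw [Subgroup.mem_normalizer_iff'']
      intro k
      rw [hM, hM, map_mul, map_mul, Equiv.Perm.mul_apply, Equiv.Perm.mul_apply, map_inv,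
        Equiv.Perm.inv_eq_iff_eq, hht, ← hcomm', (α a⁻¹).injective.eq_iff]
    refine ⟨⟨g, hg⟩, ?_⟩
    change (f ⟨g, hg⟩)⁻¹ = a
    rw [inv_eq_iff_eq_inv]
    apply hinj
    rw [← hf, ← hht]
  have hker : ψ.ker = M.subgroupOf (Subgroup.normalizer (M : Set Γ)) := by
    ext n
    rw [MonoidHom.mem_ker, Subgroup.mem_subgroupOf, hM]
    change (f n)⁻¹ = 1 ↔ _
    rw [inv_eq_one, hf n]
    constructor
    · intro h; rw [h]; simp
    · exact hfree _
  refine ⟨M, ⟨?_⟩⟩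
  exact ((QuotientGroup.quotientMulEquivOfEq hker.symm).trans
    (QuotientGroup.quotientKerEquivOfSurjective ψ hψ)).symm

/-! ### From subgroups to permutation representations -/

/-- The permutations of a coset space commuting with the action of the group. -/
def cosetAut {Γ : Type v} [Group Γ] (M : Subgroup Γ) : Subgroup (Equiv.Perm (Γ ⧸ M)) where
  carrier := {σ | ∀ (g : Γ) x, σ (g • x) = g • σ x}
  one_mem' := fun _ _ => rfl
  mul_mem' := by
    intro a b ha hb g x
    rw [Equiv.Perm.mul_apply, hb, ha, Equiv.Perm.mul_apply]
  inv_mem' := by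
    intro a ha g x
    rw [Equiv.Perm.inv_eq_iff_eq, ha, ← Equiv.Perm.mul_apply, mul_inv_cancel, Equiv.Perm.one_apply]

/-- An equivariant permutation is determined by the image `kM` of the trivial coset, and
equivariance forces `k` to normalise `M`. Right multiplication by inverses gives the homomorphism
from the normaliser, with kernel `M`. -/
theorem nonempty_normalizer_quotient_mulEquiv_cosetAut {Γ : Type v} [Group Γ] (M : Subgroup Γ) :
    Nonempty ((Subgroup.normalizer (M : Set Γ) ⧸
      M.subgroupOf (Subgroup.normalizer (M : Set Γ))) ≃* cosetAut M) := by
  let m : Subgroup.normalizer (M : Set Γ) → Γ ⧸ M → Γ ⧸ M := fun n =>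
    Quotient.map' (fun g => g * (n : Γ)⁻¹) (by
      intro a b hab
      rw [QuotientGroup.leftRel_apply] at hab ⊢
      have := (Subgroup.mem_normalizer_iff.1 n.2 (a⁻¹ * b)).1 hab
      simpa [mul_assoc] using this)
  have hm : ∀ n (g : Γ), m n (g : Γ ⧸ M) = ((g * (n : Γ)⁻¹ : Γ) : Γ ⧸ M) := fun _ _ => rfl
  have hmul : ∀ n n' x, m n (m n' x) = m (n * n') x := by
    intro n n' x
    induction x using QuotientGroup.induction_on with
    | H g => rw [hm, hm, hm]; simp [mul_assoc]
  have hone : ∀ x, m 1 x = x := by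
    intro x
    induction x using QuotientGroup.induction_on with
    | H g => rw [hm]; simp
  let ψ : Subgroup.normalizer (M : Set Γ) →* cosetAut M :=
    { toFun := fun n => ⟨⟨m n, m n⁻¹, fun x => by rw [hmul, inv_mul_cancel, hone],
        fun x => by rw [hmul, mul_inv_cancel, hone]⟩, by
        intro g x
        induction x using QuotientGroup.induction_on with
        | H k =>
          change m n ((g * k : Γ) : Γ ⧸ M) = g • m n (k : Γ ⧸ M)
          rw [hm, hm, mul_assoc]
          rfl⟩
      map_one' := by ext x; exact hone x
      map_mul' := by intro n n'; ext x; exact (hmul n n' x).symm }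
  have hψ : ∀ n (g : Γ), (ψ n : Equiv.Perm (Γ ⧸ M)) (g : Γ ⧸ M) =
    ((g * (n : Γ)⁻¹ : Γ) : Γ ⧸ M) := fun _ _ => rfl
  have hker : ψ.ker = M.subgroupOf (Subgroup.normalizer (M : Set Γ)) := by
    ext n
    rw [MonoidHom.mem_ker, Subgroup.mem_subgroupOf]
    constructor
    · intro h
      have h1 := hψ n 1
      rw [h] at h1
      have h2 := QuotientGroup.eq.1 h1
      simpa using h2
    · intro h
      ext x
      induction x using QuotientGroup.induction_on with
      | H g =>
        rw [hψ]
        refine QuotientGroup.eq.2 ?_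
        simpa using h
  have hsurj : Function.Surjective ψ := by
    rintro ⟨σ, hσ⟩
    obtain ⟨k, hk⟩ := QuotientGroup.mk_surjective (σ ((1 : Γ) : Γ ⧸ M))
    have hσ' : ∀ g : Γ, σ (g : Γ ⧸ M) = ((g * k : Γ) : Γ ⧸ M) := by
      intro g
      have := hσ g ((1 : Γ) : Γ ⧸ M)
      rw [← hk] at this
      rw [← smul_eq_mul g k, ← MulAction.Quotient.smul_coe, ← this, MulAction.Quotient.smul_coe,
        smul_eq_mul, mul_one]
    have hn : k⁻¹ ∈ Subgroup.normalizer (M : Set Γ) := by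
      rw [Subgroup.mem_normalizer_iff]
      intro h
      have e1 : h ∈ M ↔ ((1 : Γ) : Γ ⧸ M) = (h : Γ ⧸ M) := by rw [QuotientGroup.eq]; simp
      rw [e1, ← σ.injective.eq_iff, hσ', hσ', QuotientGroup.eq]
      simp [mul_assoc]
    refine ⟨⟨k⁻¹, hn⟩, ?_⟩
    ext x
    induction x using QuotientGroup.induction_on with
    | H g => rw [hψ]; simp [hσ']
  exact ⟨(QuotientGroup.quotientMulEquivOfEq hker.symm).trans
    (QuotientGroup.quotientKerEquivOfSurjective ψ hsurj)⟩

theorem GroupCARP.exists_cosetAut {Γ : Type v} [Group Γ] (h : GroupCARP.{u} Γ) (A : Type u)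
    [Group A] [Countable A] : ∃ M : Subgroup Γ, Nonempty (A ≃* cosetAut M) := by
  obtain ⟨M, ⟨e⟩⟩ := h A
  obtain ⟨e'⟩ := nonempty_normalizer_quotient_mulEquiv_cosetAut M
  exact ⟨M, ⟨e.trans e'⟩⟩

/-- Permutations of a coset space, on a copy in another universe. -/
def liftPerm {Γ : Type v} [Group Γ] (M : Subgroup Γ) :
    Γ →* Equiv.Perm (ULift.{w} (Γ ⧸ M)) :=
  (Equiv.ulift.{w}.symm.permCongrHom.toMonoidHom).comp (MulAction.toPermHom Γ (Γ ⧸ M))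

/-! ### Permutational categories and hypermaps -/

theorem GroupCARP.permutationalCARP {Γ : Type} [Group Γ] (h : GroupCARP.{u} Γ) :
    PermutationalCARP.{u, v, w, w'} Γ := by
  intro C _ e A _ _
  obtain ⟨M, ⟨E⟩⟩ := h.exists_cosetAut A
  let X : Action (Type w') Γ := Action.ofMulAction Γ (ULift.{w'} (Γ ⧸ M))
  have hX : ∀ (g : Γ) (x : ULift.{w'} (Γ ⧸ M)), X.ρ g x = g • x := fun _ _ => rfl
  have hXt : IsTransitiveRep X := by
    refine ⟨⟨ULift.up ((1 : Γ) : Γ ⧸ M)⟩, ?_⟩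
    rintro ⟨a⟩ ⟨b⟩
    obtain ⟨g, hg⟩ := MulAction.exists_smul_eq Γ a b
    exact ⟨g, congrArg ULift.up hg⟩
  -- The functor sends the chosen object only to an isomorphic copy of `X`, so transitivity has to
  -- be carried along the counit.
  have hiso : ∀ {Y : Action (Type w') Γ}, (X ≅ Y) → IsTransitiveRep Y := by
    intro Y i
    have hc : ∀ (g : Γ) y, Y.ρ g (i.hom.hom y) = i.hom.hom (X.ρ g y) := fun g y =>
      (ConcreteCategory.congr_hom (i.hom.comm g) y).symm
    have hs : ∀ y, i.hom.hom (i.inv.hom y) = y := fun y =>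
      ConcreteCategory.congr_hom (Action.inv_hom_hom i) y
    obtain ⟨⟨x⟩, ht⟩ := hXt
    refine ⟨⟨i.hom.hom x⟩, fun a b => ?_⟩
    obtain ⟨g, hg⟩ := ht (i.inv.hom a) (i.inv.hom b)
    refine ⟨g, ?_⟩
    rw [← hs a, hc, hg, hs]
  refine ⟨e.inverse.obj X, hiso (e.counitIso.app X).symm, ?_⟩
  have eX : Nonempty (cosetAut M ≃* Aut X) := by
    let f : cosetAut M → Aut X := fun σ =>
      Action.mkIso (Equiv.toIso
        ((Equiv.ulift.trans (σ : Equiv.Perm (Γ ⧸ M))).trans Equiv.ulift.symm)) (by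
        intro g
        ext x
        obtain ⟨x⟩ := x
        exact congrArg ULift.up (σ.2 g x))
    have hf : ∀ σ x, (f σ).hom.hom (ULift.up x) = ULift.up ((σ : Equiv.Perm (Γ ⧸ M)) x) :=
      fun _ _ => rfl
    refine ⟨MulEquiv.ofBijective (MonoidHom.mk' f ?_) ⟨?_, ?_⟩⟩
    · intro σ τ
      apply Iso.ext
      apply Action.hom_ext
      ext x
      rfl
    · intro σ τ hστ
      ext x
      have h1 : (f σ).hom.hom (ULift.up x) = (f τ).hom.hom (ULift.up x) :=
        congrArg (fun i : Aut X => i.hom.hom (ULift.up x)) hστ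
      rw [hf, hf] at h1
      exact congrArg ULift.down h1
    · intro i
      have hl : ∀ y, i.inv.hom (i.hom.hom y) = y := fun y =>
        ConcreteCategory.congr_hom (Action.hom_inv_hom i) y
      have hs : ∀ y, i.hom.hom (i.inv.hom y) = y := fun y =>
        ConcreteCategory.congr_hom (Action.inv_hom_hom i) y
      have hc : ∀ (g : Γ) y, i.hom.hom (X.ρ g y) = X.ρ g (i.hom.hom y) := fun g y =>
        ConcreteCategory.congr_hom (i.hom.comm g) y
      refine ⟨⟨⟨fun x => (i.hom.hom (ULift.up x)).down, fun x => (i.inv.hom (ULift.up x)).down,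
        fun x => congrArg ULift.down (hl (ULift.up x)),
        fun x => congrArg ULift.down (hs (ULift.up x))⟩,
        fun g x => congrArg ULift.down (hc g (ULift.up x))⟩, ?_⟩
      apply Iso.ext
      apply Action.hom_ext
      ext x
      rfl
  obtain ⟨eX⟩ := eX
  exact ⟨E.trans (eX.trans (e.fullyFaithfulInverse.autMulEquivOfFullyFaithful X))⟩

theorem isPretransitive_closure_of_liftPerm {Γ : Type v} [Group Γ] (M : Subgroup Γ)
    {H : Subgroup (Equiv.Perm (ULift.{w} (Γ ⧸ M)))} (hH : (liftPerm.{v, w} M).range ≤ H) :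
    MulAction.IsPretransitive H (ULift.{w} (Γ ⧸ M)) := by
  constructor
  rintro ⟨a⟩ ⟨b⟩
  obtain ⟨g, hg⟩ := MulAction.exists_smul_eq Γ a b
  exact ⟨⟨liftPerm M g, hH ⟨g, rfl⟩⟩, congrArg ULift.up hg⟩

theorem PresentedGroup.hom_range_le {α : Type*} {rels : Set (FreeGroup α)} {G : Type*} [Group G]
    (φ : PresentedGroup rels →* G) (H : Subgroup G)
    (h : ∀ i, φ (PresentedGroup.of i) ∈ H) : φ.range ≤ H := by
  rw [MonoidHom.range_eq_map, ← PresentedGroup.closure_range_of, MonoidHom.map_closure,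
    Subgroup.closure_le]
  rintro _ ⟨_, ⟨i, rfl⟩, rfl⟩
  exact h i

/-- Morphisms of hypermaps commute only with the named generators; the elements with which `σ`
commutes form a subgroup, so this suffices. -/
theorem PresentedGroup.mem_cosetAut {α : Type*} {rels : Set (FreeGroup α)}
    (M : Subgroup (PresentedGroup rels)) (σ : Equiv.Perm (PresentedGroup rels ⧸ M))
    (h : ∀ (i : α) x, σ (PresentedGroup.of (rels := rels) i • x) =
      PresentedGroup.of (rels := rels) i • σ x) : σ ∈ cosetAut M := by
  intro g
  let K : Subgroup (PresentedGroup rels) :=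
    { carrier := {g | ∀ x, σ (g • x) = g • σ x}
      one_mem' := by intro x; simp
      mul_mem' := by
        intro a b ha hb x
        rw [mul_smul, ha, hb, mul_smul]
      inv_mem' := by
        intro a ha x
        rw [eq_inv_smul_iff, ← ha, smul_inv_smul] }
  exact PresentedGroup.generated_by rels K h g

theorem powRel_eq_one {α : Type*} {rels : Set (FreeGroup α)} {g : FreeGroup α} {n : ℕ∞}
    (h : powRel g n ⊆ rels) : PowEqOne (PresentedGroup.mk rels g) n := by
  intro k hk
  rw [← map_pow]
  exact PresentedGroup.one_of_mem (h ⟨k, hk, rfl⟩)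

theorem PowEqOne.map {G H : Type*} [Group G] [Group H] {g : G} {n : ℕ∞} (h : PowEqOne g n)
    (φ : G →* H) : PowEqOne (φ g) n := by
  intro k hk
  rw [← map_pow, h k hk, map_one]

theorem GroupCARP.orientedHypermap {p q r : ℕ∞} (h : GroupCARP.{u} (TriangleGroup p q r)) :
    CategoryCARP.{u} (OrientedHypermap.{v} p q r) OrientedHypermap.IsConn := by
  intro A _ _
  obtain ⟨M, ⟨E⟩⟩ := h.exists_cosetAut A
  let φ := liftPerm.{0, v} M
  let g : TriGen → TriangleGroup p q r := PresentedGroup.of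
  let O : OrientedHypermap.{v} p q r :=
    { Ω := ULift.{v} (TriangleGroup p q r ⧸ M)
      x := φ (g .X), y := φ (g .Y), z := φ (g .Z)
      xyz := by
        rw [← map_mul, ← map_mul]
        have : g .X * g .Y * g .Z = 1 :=
          PresentedGroup.one_of_mem (rels := triangleRels p q r) (Or.inr rfl)
        rw [this, map_one]
      x_pow := PowEqOne.map (powRel_eq_one (rels := triangleRels p q r) fun _ ht => Or.inl (Or.inl (Or.inl ht))) φ
      y_pow := PowEqOne.map (powRel_eq_one (rels := triangleRels p q r) fun _ ht => Or.inl (Or.inl (Or.inr ht))) φ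
      z_pow := PowEqOne.map (powRel_eq_one (rels := triangleRels p q r) fun _ ht => Or.inl (Or.inr ht)) φ }
  refine ⟨O, ⟨⟨ULift.up ((1 : TriangleGroup p q r) : TriangleGroup p q r ⧸ M)⟩,
    isPretransitive_closure_of_liftPerm M (PresentedGroup.hom_range_le _ _ ?_)⟩, ?_⟩
  · rintro (_ | _ | _) <;> apply Subgroup.subset_closure
    · exact Or.inl rfl
    · exact Or.inr (Or.inl rfl)
    · exact Or.inr (Or.inr rfl)
  have hF : ∀ σ ∈ cosetAut M, ∀ i (a : O.Ω), ULift.up (σ (φ (g i) a).down) =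
      φ (g i) (ULift.up (σ a.down)) := by
    rintro σ hσ i ⟨a⟩
    exact congrArg ULift.up (hσ (g i) a)
  let F : cosetAut M → (O ⟶ O) := fun σ =>
    (⟨fun a => ULift.up ((σ : Equiv.Perm _) a.down), hF σ σ.2 .X, hF σ σ.2 .Y, hF σ σ.2 .Z⟩ :
      OrientedHypermap.Hom O O)
  have hFc : ∀ σ τ, F σ ≫ F τ = F (τ * σ) := fun _ _ => rfl
  have hF1 : F 1 = 𝟙 O := rfl
  let f : cosetAut M → Aut O := fun σ => ⟨F σ, F σ⁻¹, by rw [hFc, inv_mul_cancel, hF1],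
    by rw [hFc, mul_inv_cancel, hF1]⟩
  refine ⟨E.trans (MulEquiv.ofBijective (MonoidHom.mk' f fun σ τ => Iso.ext rfl) ⟨?_, ?_⟩)⟩
  · intro σ τ hστ
    ext x
    exact congrArg ULift.down
      (congrArg (fun i : Aut O => OrientedHypermap.Hom.toFun i.hom (ULift.up x)) hστ)
  · intro i
    let s := OrientedHypermap.Hom.toFun i.hom
    let t := OrientedHypermap.Hom.toFun i.inv
    have hl : ∀ y, t (s y) = y := fun y =>
      congrArg (fun k : O ⟶ O => OrientedHypermap.Hom.toFun k y) i.hom_inv_id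
    have hs : ∀ y, s (t y) = y := fun y =>
      congrArg (fun k : O ⟶ O => OrientedHypermap.Hom.toFun k y) i.inv_hom_id
    refine ⟨⟨⟨fun x => (s (ULift.up x)).down, fun x => (t (ULift.up x)).down,
        fun x => congrArg ULift.down (hl (ULift.up x)),
        fun x => congrArg ULift.down (hs (ULift.up x))⟩,
        PresentedGroup.mem_cosetAut M _ ?_⟩, Iso.ext rfl⟩
    rintro (_ | _ | _) x
    · exact congrArg ULift.down (OrientedHypermap.Hom.map_x i.hom (ULift.up x))
    · exact congrArg ULift.down (OrientedHypermap.Hom.map_y i.hom (ULift.up x))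
    · exact congrArg ULift.down (OrientedHypermap.Hom.map_z i.hom (ULift.up x))

theorem GroupCARP.hypermap {p q r : ℕ∞} (h : GroupCARP.{u} (ExtTriangleGroup p q r)) :
    CategoryCARP.{u} (Hypermap.{v} p q r) Hypermap.IsConn := by
  intro A _ _
  obtain ⟨M, ⟨E⟩⟩ := h.exists_cosetAut A
  let φ := liftPerm.{0, v} M
  let g : RefGen → ExtTriangleGroup p q r := PresentedGroup.of
  have hsq : ∀ i, φ (g i) ^ 2 = 1 := by
    intro i
    have : g i ^ 2 = 1 := PresentedGroup.one_of_mem (rels := extTriangleRels p q r)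
      (Or.inl (Or.inl (Or.inl ⟨i, rfl⟩)))
    rw [← map_pow, this, map_one]
  have hpow : ∀ i j n, powRel (FreeGroup.of i * FreeGroup.of j) n ⊆ extTriangleRels p q r →
      PowEqOne (φ (g i) * φ (g j)) n := by
    intro i j n hn
    rw [← map_mul]
    exact PowEqOne.map (powRel_eq_one hn) φ
  let O : Hypermap.{v} p q r :=
    { Ω := ULift.{v} (ExtTriangleGroup p q r ⧸ M)
      r₀ := φ (g .R₀), r₁ := φ (g .R₁), r₂ := φ (g .R₂)
      r₀_sq := hsq _, r₁_sq := hsq _, r₂_sq := hsq _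
      pow_p := hpow _ _ _ fun _ ht => Or.inl (Or.inl (Or.inr ht))
      pow_q := hpow _ _ _ fun _ ht => Or.inl (Or.inr ht)
      pow_r := hpow _ _ _ fun _ ht => Or.inr ht }
  refine ⟨O, ⟨⟨ULift.up ((1 : ExtTriangleGroup p q r) : ExtTriangleGroup p q r ⧸ M)⟩,
    isPretransitive_closure_of_liftPerm M (PresentedGroup.hom_range_le _ _ ?_)⟩, ?_⟩
  · rintro (_ | _ | _) <;> apply Subgroup.subset_closure
    · exact Or.inl rfl
    · exact Or.inr (Or.inl rfl)
    · exact Or.inr (Or.inr rfl)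
  have hF : ∀ σ ∈ cosetAut M, ∀ i (a : O.Ω), ULift.up (σ (φ (g i) a).down) =
      φ (g i) (ULift.up (σ a.down)) := by
    rintro σ hσ i ⟨a⟩
    exact congrArg ULift.up (hσ (g i) a)
  let F : cosetAut M → (O ⟶ O) := fun σ =>
    (⟨fun a => ULift.up ((σ : Equiv.Perm _) a.down), hF σ σ.2 .R₀, hF σ σ.2 .R₁, hF σ σ.2 .R₂⟩ :
      Hypermap.Hom O O)
  have hFc : ∀ σ τ, F σ ≫ F τ = F (τ * σ) := fun _ _ => rfl
  have hF1 : F 1 = 𝟙 O := rfl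
  let f : cosetAut M → Aut O := fun σ => ⟨F σ, F σ⁻¹, by rw [hFc, inv_mul_cancel, hF1],
    by rw [hFc, mul_inv_cancel, hF1]⟩
  refine ⟨E.trans (MulEquiv.ofBijective (MonoidHom.mk' f fun σ τ => Iso.ext rfl) ⟨?_, ?_⟩)⟩
  · intro σ τ hστ
    ext x
    exact congrArg ULift.down
      (congrArg (fun i : Aut O => Hypermap.Hom.toFun i.hom (ULift.up x)) hστ)
  · intro i
    let s := Hypermap.Hom.toFun i.hom
    let t := Hypermap.Hom.toFun i.inv
    have hl : ∀ y, t (s y) = y := fun y =>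
      congrArg (fun k : O ⟶ O => Hypermap.Hom.toFun k y) i.hom_inv_id
    have hs : ∀ y, s (t y) = y := fun y =>
      congrArg (fun k : O ⟶ O => Hypermap.Hom.toFun k y) i.inv_hom_id
    refine ⟨⟨⟨fun x => (s (ULift.up x)).down, fun x => (t (ULift.up x)).down,
        fun x => congrArg ULift.down (hl (ULift.up x)),
        fun x => congrArg ULift.down (hs (ULift.up x))⟩,
        PresentedGroup.mem_cosetAut M _ ?_⟩, Iso.ext rfl⟩
    rintro (_ | _ | _) x
    · exact congrArg ULift.down (Hypermap.Hom.map_r₀ i.hom (ULift.up x))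
    · exact congrArg ULift.down (Hypermap.Hom.map_r₁ i.hom (ULift.up x))
    · exact congrArg ULift.down (Hypermap.Hom.map_r₂ i.hom (ULift.up x))

/-! ### A plane tree with one face, and its coverings -/

/-- The kinds of end of the first branch of the tree: a free edge, a vertex of valency one, or
a loop. -/
inductive EndKind : Type
  | half | leaf | loop

/-- The darts of a trivalent caterpillar: a vertex `q`, one of whose branches is a leaf `l` and
another an end of given kind, followed by a path of `k + 1` trivalent vertices carrying free
edges. -/
inductive Dart (k : ℕ) : EndKind → Type
  | q0 {t : EndKind} : Dart k t
  | q1 {t : EndKind} : Dart k t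
  | q2 {t : EndKind} : Dart k t
  | l {t : EndKind} : Dart k t
  | inn {t : EndKind} (i : ℕ) (h : i ≤ k) : Dart k t
  | mid {t : EndKind} (i : ℕ) (h : i ≤ k) : Dart k t
  | out {t : EndKind} (i : ℕ) (h : i ≤ k) : Dart k t
  | leaf : Dart k .leaf
  | l0 : Dart k .loop
  | l1 : Dart k .loop
  | l2 : Dart k .loop

/-- The period of the rotation at the end of the first branch. -/
def EndKind.period : EndKind → ℕ
  | .half => 2
  | .leaf => 3
  | .loop => 3

/-- The number of additional darts which the end of the first branch contributes to the face. -/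
def EndKind.weight : EndKind → ℕ
  | .half => 0
  | .leaf => 1
  | .loop => 2

section Cover

variable {S : Type u} {k : ℕ}

/-- The involution of a covering of the tree, with permutations of the sheets as monodromy around
the free edges and the end of the first branch. -/
def edgeFun (e c₁ c₂ : Equiv.Perm S) : ∀ t : EndKind, S × Dart k t → S × Dart k t
  | _, (s, .q0) => (s, .inn 0 (Nat.zero_le k))
  | .half, (s, .q1) => (e s, .q1)
  | .leaf, (s, .q1) => (s, .leaf)
  | .loop, (s, .q1) => (s, .l0)
  | _, (s, .q2) => (s, .l)
  | _, (s, .l) => (s, .q2)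
  | _, (s, .inn 0 _) => (s, .q0)
  | _, (s, .inn (i + 1) h) => (s, .out i (by omega))
  | _, (s, .mid 0 h) => (c₁ s, .mid 0 h)
  | _, (s, .mid (i + 1) h) => (s, .mid (i + 1) h)
  | _, (s, .out i h) => if h' : i < k then (s, .inn (i + 1) h') else (c₂ s, .out i h)
  | _, (s, .leaf) => (s, .q1)
  | _, (s, .l0) => (s, .q1)
  | _, (s, .l1) => (e s, .l2)
  | _, (s, .l2) => (e⁻¹ s, .l1)

/-- The rotation around the vertices in a covering of the tree. -/
def vertexFun (d e : Equiv.Perm S) : ∀ t : EndKind, S × Dart k t → S × Dart k t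
  | _, (s, .q0) => (s, .q1)
  | _, (s, .q1) => (s, .q2)
  | _, (s, .q2) => (s, .q0)
  | _, (s, .l) => (d s, .l)
  | _, (s, .inn i h) => (s, .mid i h)
  | _, (s, .mid i h) => (s, .out i h)
  | _, (s, .out i h) => (s, .inn i h)
  | _, (s, .leaf) => (e s, .leaf)
  | _, (s, .l0) => (s, .l1)
  | _, (s, .l1) => (s, .l2)
  | _, (s, .l2) => (s, .l0)

variable {d e c₁ c₂ : Equiv.Perm S} {t : EndKind}

theorem perm_sq_apply {σ : Equiv.Perm S} (h : σ ^ 2 = 1) (s : S) : σ (σ s) = s := by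
  rw [← Equiv.Perm.mul_apply, ← sq, h, Equiv.Perm.one_apply]

theorem perm_cube_apply {σ : Equiv.Perm S} (h : σ ^ 3 = 1) (s : S) : σ (σ (σ s)) = s := by
  rw [← Equiv.Perm.mul_apply, ← Equiv.Perm.mul_apply, ← sq, ← pow_succ, h, Equiv.Perm.one_apply]

theorem edgeFun_edgeFun (he : e ^ t.period = 1) (h₁ : c₁ ^ 2 = 1) (h₂ : c₂ ^ 2 = 1)
    (ω : S × Dart k t) : edgeFun e c₁ c₂ t (edgeFun e c₁ c₂ t ω) = ω := by
  obtain ⟨s, δ⟩ := ω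
  cases δ with
  | q1 => cases t <;> simp [edgeFun]; exact perm_sq_apply he s
  | inn i h =>
    cases i with
    | zero => simp [edgeFun]
    | succ i => simp [edgeFun, Nat.lt_of_succ_le h]
  | mid i h => cases i <;> simp [edgeFun, perm_sq_apply h₁]
  | out i h =>
    by_cases h' : i < k
    · simp [edgeFun, h']
    · simp [edgeFun, h', perm_sq_apply h₂]
  | _ => simp [edgeFun]

theorem vertexFun_vertexFun_vertexFun (hd : d ^ 3 = 1) (he : e ^ t.period = 1)
    (ω : S × Dart k t) : vertexFun d e t (vertexFun d e t (vertexFun d e t ω)) = ω := by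
  obtain ⟨s, δ⟩ := ω
  cases δ with
  | l => simp [vertexFun, perm_cube_apply hd]
  | leaf => simp only [vertexFun]; rw [perm_cube_apply he]
  | _ => simp [vertexFun]

/-- Monodromy permutations around the ends of the tree. -/
structure Monodromy (S : Type u) (t : EndKind) where
  d : Equiv.Perm S
  e : Equiv.Perm S
  c₁ : Equiv.Perm S
  c₂ : Equiv.Perm S
  d_pow : d ^ 3 = 1
  e_pow : e ^ t.period = 1
  c₁_sq : c₁ ^ 2 = 1
  c₂_sq : c₂ ^ 2 = 1
  prod_eq : ∀ s, e (c₂ (c₁ (d s))) = s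

namespace Monodromy

variable (μ : Monodromy S t) (k)

/-- The involution `x` of the covering. -/
def edgePerm : Equiv.Perm (S × Dart k t) :=
  ⟨edgeFun μ.e μ.c₁ μ.c₂ t, edgeFun μ.e μ.c₁ μ.c₂ t,
    edgeFun_edgeFun μ.e_pow μ.c₁_sq μ.c₂_sq, edgeFun_edgeFun μ.e_pow μ.c₁_sq μ.c₂_sq⟩

/-- The permutation `y` of order three of the covering. -/
def vertexPerm : Equiv.Perm (S × Dart k t) :=
  ⟨vertexFun μ.d μ.e t, fun ω => vertexFun μ.d μ.e t (vertexFun μ.d μ.e t ω),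
    vertexFun_vertexFun_vertexFun μ.d_pow μ.e_pow, vertexFun_vertexFun_vertexFun μ.d_pow μ.e_pow⟩

theorem edgePerm_apply (ω) : μ.edgePerm k ω = edgeFun μ.e μ.c₁ μ.c₂ t ω := rfl

theorem edgePerm_symm_apply (ω) : (μ.edgePerm k).symm ω = edgeFun μ.e μ.c₁ μ.c₂ t ω := rfl

theorem vertexPerm_apply (ω) : μ.vertexPerm k ω = vertexFun μ.d μ.e t ω := rfl

theorem vertexPerm_symm_apply (ω) :
    (μ.vertexPerm k).symm ω = vertexFun μ.d μ.e t (vertexFun μ.d μ.e t ω) := rfl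

theorem edgePerm_sq : μ.edgePerm k ^ 2 = 1 := by
  ext1 ω
  exact edgeFun_edgeFun μ.e_pow μ.c₁_sq μ.c₂_sq ω

theorem vertexPerm_cube : μ.vertexPerm k ^ 3 = 1 := by
  ext1 ω
  exact vertexFun_vertexFun_vertexFun μ.d_pow μ.e_pow ω

/-- The rotation around the faces. -/
def facePerm : Equiv.Perm (S × Dart k t) := μ.edgePerm k * μ.vertexPerm k

theorem facePerm_apply (ω) : μ.facePerm k ω = edgeFun μ.e μ.c₁ μ.c₂ t (vertexFun μ.d μ.e t ω) :=
  rfl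

/-! ### The face walk and its monodromy -/

theorem facePerm_l (s : S) : μ.facePerm k (s, .l) = (μ.d s, .q2) := by
  simp [facePerm_apply, edgeFun, vertexFun]

theorem facePerm_q2 (s : S) : μ.facePerm k (s, .q2) = (s, .inn 0 (Nat.zero_le k)) := by
  simp [facePerm_apply, edgeFun, vertexFun]

theorem facePerm_inn (s : S) : μ.facePerm k (s, .inn 0 (Nat.zero_le k)) =
    (μ.c₁ s, .mid 0 (Nat.zero_le k)) := by
  simp [facePerm_apply, edgeFun, vertexFun]

theorem facePerm_mid (s : S) (i : ℕ) (h : i < k) :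
    μ.facePerm k (s, .mid i h.le) = (s, .inn (i + 1) h) := by
  simp [facePerm_apply, edgeFun, vertexFun, h]

theorem facePerm_inn_succ (s : S) (i : ℕ) (h : i < k) :
    μ.facePerm k (s, .inn (i + 1) h) = (s, .mid (i + 1) h) := by
  simp [facePerm_apply, edgeFun, vertexFun]

theorem facePerm_mid_last (s : S) :
    μ.facePerm k (s, .mid k le_rfl) = (μ.c₂ s, .out k le_rfl) := by
  simp [facePerm_apply, edgeFun, vertexFun]

theorem facePerm_out_succ (s : S) (i : ℕ) (h : i < k) :
    μ.facePerm k (s, .out (i + 1) h) = (s, .out i h.le) := by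
  simp [facePerm_apply, edgeFun, vertexFun]

theorem facePerm_out_zero (s : S) :
    μ.facePerm k (s, .out 0 (Nat.zero_le k)) = (s, .q0) := by
  simp [facePerm_apply, edgeFun, vertexFun]

theorem facePerm_pow_mid (s : S) (i : ℕ) (h : i ≤ k) :
    (μ.facePerm k ^ (2 * i)) (s, .mid 0 (Nat.zero_le k)) = (s, .mid i h) := by
  induction i with
  | zero => rfl
  | succ i ih =>
    rw [show 2 * (i + 1) = 1 + (1 + 2 * i) by ring, pow_add, pow_add, pow_one,
      Equiv.Perm.mul_apply, Equiv.Perm.mul_apply, ih (by omega), facePerm_mid,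
      facePerm_inn_succ]

theorem facePerm_pow_out (s : S) (i : ℕ) (h : i ≤ k) :
    (μ.facePerm k ^ i) (s, .out i h) = (s, .out 0 (Nat.zero_le k)) := by
  induction i with
  | zero => rfl
  | succ i ih => rw [pow_succ, Equiv.Perm.mul_apply, facePerm_out_succ, ih]

/-- The part of the outer face around the first branch: two steps, plus one around a leaf or two
around a loop. It picks up exactly `e`. -/
theorem facePerm_pow_q0 (s : S) : (μ.facePerm k ^ (2 + t.weight)) (s, .q0) = (μ.e s, .l) := by
  cases t <;> simp [EndKind.weight, pow_succ, facePerm_apply, edgeFun, vertexFun]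

/-- The rest of the outer face: out along the `mid` darts at two steps per vertex, back along the
`out` darts at one, meeting both branched free edges. -/
theorem facePerm_pow_l (s : S) : (μ.facePerm k ^ (5 + 3 * k)) (s, .l) =
    (μ.c₂ (μ.c₁ (μ.d s)), .q0) := by
  rw [show 5 + 3 * k = 1 + (k + (1 + (2 * k + (1 + (1 + 1))))) by ring]
  simp only [pow_add, pow_one, Equiv.Perm.mul_apply]
  rw [facePerm_l, facePerm_q2, facePerm_inn, facePerm_pow_mid _ _ _ _ le_rfl, facePerm_mid_last,
    facePerm_pow_out, facePerm_out_zero]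

/-- One circuit of the outer face has monodromy `e c₂ c₁ d`, which is trivial. Being fixed by the
`n`-th power propagates along the face, so one dart `l` on each sheet is enough. -/
theorem facePerm_pow (n : ℕ) (hn : n = 7 + 3 * k + t.weight) : μ.facePerm k ^ n = 1 := by
  have key : ∀ ω, (μ.facePerm k ^ n) ω = ω →
      (μ.facePerm k ^ n) (μ.facePerm k ω) = μ.facePerm k ω := by
    intro ω h
    rw [← Equiv.Perm.mul_apply, ← pow_succ, pow_succ', Equiv.Perm.mul_apply, h]
  have hl : ∀ s, (μ.facePerm k ^ n) (s, .l) = (s, .l) := by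
    intro s
    rw [hn, show 7 + 3 * k + t.weight = (2 + t.weight) + (5 + 3 * k) by ring, pow_add,
      Equiv.Perm.mul_apply, facePerm_pow_l, facePerm_pow_q0, μ.prod_eq]
  have hq2 : ∀ s, (μ.facePerm k ^ n) (s, .q2) = (s, .q2) := by
    intro s
    simpa [facePerm_l] using key _ (hl (μ.d.symm s))
  have hi0 : ∀ s, (μ.facePerm k ^ n) (s, .inn 0 (Nat.zero_le k)) = (s, .inn 0 (Nat.zero_le k)) := by
    intro s
    simpa [facePerm_q2] using key _ (hq2 s)
  have hm0 : ∀ s, (μ.facePerm k ^ n) (s, .mid 0 (Nat.zero_le k)) = (s, .mid 0 (Nat.zero_le k)) := by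
    intro s
    simpa [facePerm_inn] using key _ (hi0 (μ.c₁.symm s))
  have him : ∀ i (h : i < k) s, (μ.facePerm k ^ n) (s, .mid i h.le) = (s, .mid i h.le) →
      (μ.facePerm k ^ n) (s, .inn (i + 1) h) = (s, .inn (i + 1) h) := by
    intro i h s hs
    simpa [facePerm_mid _ _ _ _ h] using key _ hs
  have hm : ∀ i (h : i ≤ k) s, (μ.facePerm k ^ n) (s, .mid i h) = (s, .mid i h) := by
    intro i
    induction i with
    | zero => exact fun _ => hm0
    | succ i ih =>
      intro h s
      simpa [facePerm_inn_succ _ _ _ _ h] using key _ (him i h s (ih _ s))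
  have ho : ∀ j i (h : i ≤ k) s, i + j = k →
      (μ.facePerm k ^ n) (s, .out i h) = (s, .out i h) := by
    intro j
    induction j with
    | zero =>
      intro i h s hij
      obtain rfl : i = k := by omega
      simpa [facePerm_mid_last] using key _ (hm _ le_rfl (μ.c₂.symm s))
    | succ j ih =>
      intro i h s hij
      have h' : i < k := by omega
      simpa [facePerm_out_succ _ _ _ _ h'] using key _ (ih (i + 1) h' s (by omega))
  have hq0 : ∀ s, (μ.facePerm k ^ n) (s, .q0) = (s, .q0) := by
    intro s
    simpa [facePerm_out_zero] using key _ (ho k 0 (Nat.zero_le k) s (by omega))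
  ext1 ⟨s, δ⟩
  rw [Equiv.Perm.one_apply]
  cases δ with
  | q0 => exact hq0 s
  | q2 => exact hq2 s
  | l => exact hl s
  | inn i h =>
    cases i with
    | zero => exact hi0 s
    | succ i => exact him i h s (hm i _ s)
  | mid i h => exact hm i h s
  | out i h => exact ho (k - i) i h s (by omega)
  | leaf => simpa [facePerm_apply, edgeFun, vertexFun] using key _ (hq0 s)
  | l0 => simpa [facePerm_apply, edgeFun, vertexFun] using key _ (hq0 s)
  | l2 =>
    simpa [facePerm_apply, edgeFun, vertexFun] using key _ (key _ (hq0 (μ.e.symm s)))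
  -- The inside of the loop is a second face, of length one, with monodromy `e⁻¹`. Its cube is
  -- trivial, and three divides `n = 9 + 3k` for this end.
  | l1 =>
    have h1 : ∀ j s, (μ.facePerm k ^ j) (s, .l1) = ((μ.e⁻¹ ^ j) s, .l1) := by
      intro j
      induction j with
      | zero => intro s; rfl
      | succ j ih =>
        intro s
        rw [pow_succ', Equiv.Perm.mul_apply, ih, pow_succ', Equiv.Perm.mul_apply]
        rfl
    rw [h1]
    have h2 : μ.e⁻¹ ^ n = 1 := by
      have : n = 3 * (3 + k) := by rw [hn, EndKind.weight]; ring
      have he : μ.e ^ 3 = 1 := μ.e_pow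
      rw [this, pow_mul, inv_pow, he, inv_one, one_pow]
    rw [h2, Equiv.Perm.one_apply]
  | q1 =>
    cases t with
    | half => simpa [facePerm_apply, edgeFun, vertexFun] using key _ (hq0 (μ.e.symm s))
    | leaf =>
      simpa [facePerm_apply, edgeFun, vertexFun] using key _ (key _ (hq0 (μ.e.symm s)))
    | loop =>
      simpa [facePerm_apply, edgeFun, vertexFun] using key _ (key _ (key _ (hq0 (μ.e.symm s))))

end Monodromy

end Cover

/-! ### Doubling a covering -/

section Double

variable {Ω : Type u} (x y : Equiv.Perm Ω)

/-- The reflection exchanging the two copies of `Ω`. -/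
def swapPerm (Ω : Type u) : Equiv.Perm (Ω × Bool) where
  toFun ω := (ω.1, !ω.2)
  invFun ω := (ω.1, !ω.2)
  left_inv := by rintro ⟨ω, b⟩; simp
  right_inv := by rintro ⟨ω, b⟩; simp

/-- The permutation acting as `x` on one copy of `Ω`, and as its inverse on the other. -/
def doublePerm : Equiv.Perm (Ω × Bool) where
  toFun ω := (if ω.2 then x ω.1 else x.symm ω.1, ω.2)
  invFun ω := (if ω.2 then x.symm ω.1 else x ω.1, ω.2)
  left_inv := by rintro ⟨ω, _ | _⟩ <;> simp
  right_inv := by rintro ⟨ω, _ | _⟩ <;> simp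

variable {x y}

@[simp]
theorem swapPerm_apply (ω : Ω) (b : Bool) : swapPerm Ω (ω, b) = (ω, !b) := rfl

@[simp]
theorem doublePerm_true (ω : Ω) : doublePerm x (ω, true) = (x ω, true) := rfl

@[simp]
theorem doublePerm_false (ω : Ω) : doublePerm x (ω, false) = (x.symm ω, false) := rfl

@[simp]
theorem doublePerm_symm_true (ω : Ω) : (doublePerm x).symm (ω, true) = (x.symm ω, true) := rfl

theorem swapPerm_sq : swapPerm Ω ^ 2 = 1 := by
  ext1 ⟨ω, b⟩
  simp [sq]

theorem doublePerm_pow_true (n : ℕ) (ω : Ω) :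
    (doublePerm x ^ n) (ω, true) = ((x ^ n) ω, true) := by
  induction n generalizing ω with
  | zero => rfl
  | succ n ih => rw [pow_succ, Equiv.Perm.mul_apply, doublePerm_true, ih, pow_succ]; rfl

theorem doublePerm_pow_false (n : ℕ) (ω : Ω) :
    (doublePerm x ^ n) (ω, false) = ((x⁻¹ ^ n) ω, false) := by
  induction n generalizing ω with
  | zero => rfl
  | succ n ih => rw [pow_succ, Equiv.Perm.mul_apply, doublePerm_false, ih, pow_succ]; rfl

theorem doublePerm_pow {n : ℕ} (h : x ^ n = 1) : doublePerm x ^ n = 1 := by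
  ext1 ⟨ω, b⟩
  cases b
  · rw [doublePerm_pow_false, inv_pow, h]; simp
  · rw [doublePerm_pow_true, h]; rfl

theorem swapPerm_mul_doublePerm_sq : (swapPerm Ω * doublePerm x) ^ 2 = 1 := by
  ext1 ⟨ω, b⟩
  cases b <;> simp [sq]

theorem swapPerm_mul_swapPerm_mul (σ : Equiv.Perm (Ω × Bool)) :
    swapPerm Ω * (swapPerm Ω * σ) = σ := by
  rw [← mul_assoc, ← sq, swapPerm_sq, one_mul]

/-- On one copy the product acts as `xy`, using `x = x⁻¹`; on the other it acts as `(yx)⁻¹`, and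
`yx` is conjugate to `xy`. -/
theorem doublePerm_mul_pow {n : ℕ} (hx : x ^ 2 = 1) (h : (x * y) ^ n = 1) :
    (swapPerm Ω * doublePerm x * (swapPerm Ω * doublePerm y)) ^ n = 1 := by
  have hx' : x⁻¹ = x := by rw [inv_eq_iff_mul_eq_one, ← sq, hx]
  have ht : ∀ m ω, ((swapPerm Ω * doublePerm x * (swapPerm Ω * doublePerm y)) ^ m) (ω, true) =
      (((x * y) ^ m) ω, true) := by
    intro m
    induction m with
    | zero => intro ω; rfl
    | succ m ih =>
      intro ω
      rw [pow_succ, Equiv.Perm.mul_apply, pow_succ (x * y), Equiv.Perm.mul_apply _ (x * y), ← ih]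
      congr 1
      nth_rw 2 [← hx']
      rfl
  have hf : ∀ m ω, ((swapPerm Ω * doublePerm x * (swapPerm Ω * doublePerm y)) ^ m) (ω, false) =
      (((y * x)⁻¹ ^ m) ω, false) := by
    intro m
    induction m with
    | zero => intro ω; rfl
    | succ m ih =>
      intro ω
      rw [pow_succ, Equiv.Perm.mul_apply, pow_succ (y * x)⁻¹, Equiv.Perm.mul_apply _ (y * x)⁻¹,
        ← ih]
      congr 1
      rw [mul_inv_rev, hx']
      rfl
  have hyx : (y * x) ^ n = 1 := by
    have : y * x = x⁻¹ * (x * y) * x⁻¹⁻¹ := by group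
    rw [this, conj_pow, h]
    group
  ext1 ⟨ω, b⟩
  cases b
  · rw [hf, inv_pow, hyx]; simp
  · rw [ht, h]; rfl

end Double

/-! ### Rigidity of the coverings -/

/-- An action of `A` on the sheets, commuting with the monodromy and such that the common fixed
points of the monodromy around two of the ends form a regular orbit. -/
structure RigidMonodromy (A : Type w) [Group A] (S : Type u) (t : EndKind) extends
    Monodromy S t where
  act : A →* Equiv.Perm S
  base : S
  act_d : ∀ a s, act a (d s) = d (act a s)
  act_e : ∀ a s, act a (e s) = e (act a s)
  act_c₁ : ∀ a s, act a (c₁ s) = c₁ (act a s)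
  act_c₂ : ∀ a s, act a (c₂ s) = c₂ (act a s)
  free : ∀ a, act a base = base → a = 1
  d_base : d base = base
  c₁_base : c₁ base = base
  eq_act : ∀ s, d s = s → c₁ s = s → ∃ a, s = act a base
  e_c₂ : ∀ s, e s = s → c₂ s ≠ s
  conn : ∀ a, ∃ h ∈ Subgroup.closure {d, e, c₁}, h base = act a base

namespace RigidMonodromy

variable {A : Type w} [Group A] {S : Type u} {t : EndKind} (μ : RigidMonodromy A S t) (k : ℕ)

/-- The action of `A` on the doubled covering. -/
def doubleAct : A →* Equiv.Perm ((S × Dart k t) × Bool) where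
  toFun a := ((μ.act a).prodCongr (Equiv.refl _)).prodCongr (Equiv.refl _)
  map_one' := by ext1 ⟨⟨s, δ⟩, b⟩; simp
  map_mul' a a' := by ext1 ⟨⟨s, δ⟩, b⟩; simp

@[simp]
theorem doubleAct_apply (a : A) (s : S) (δ : Dart k t) (b : Bool) :
    μ.doubleAct k a ((s, δ), b) = ((μ.act a s, δ), b) := rfl

theorem doubleAct_edgePerm (a : A) (ω : (S × Dart k t) × Bool) :
    μ.doubleAct k a (doublePerm (μ.edgePerm k) ω) =
      doublePerm (μ.edgePerm k) (μ.doubleAct k a ω) := by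
  have hinv : ∀ s, μ.act a (μ.e.symm s) = μ.e.symm (μ.act a s) := by
    intro s
    rw [Equiv.eq_symm_apply, ← μ.act_e, Equiv.apply_symm_apply]
  have h : ∀ s δ, ((μ.act a (μ.edgePerm k (s, δ)).1, (μ.edgePerm k (s, δ)).2) : S × Dart k t) =
      μ.edgePerm k (μ.act a s, δ) := by
    intro s δ
    simp only [Monodromy.edgePerm_apply]
    cases δ with
    | q1 => cases t <;> simp [edgeFun, μ.act_e]
    | inn i h => cases i <;> simp [edgeFun]
    | mid i h => cases i <;> simp [edgeFun, μ.act_c₁]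
    | out i h => by_cases h' : i < k <;> simp [edgeFun, h', μ.act_c₂]
    | _ => simp [edgeFun, μ.act_e, hinv]
  obtain ⟨⟨s, δ⟩, _ | _⟩ := ω
  · exact congrArg (fun z => (z, false)) (h s δ)
  · exact congrArg (fun z => (z, true)) (h s δ)

theorem doubleAct_vertexPerm (a : A) (ω : (S × Dart k t) × Bool) :
    μ.doubleAct k a (doublePerm (μ.vertexPerm k) ω) =
      doublePerm (μ.vertexPerm k) (μ.doubleAct k a ω) := by
  have h : ∀ s δ, ((μ.act a (μ.vertexPerm k (s, δ)).1, (μ.vertexPerm k (s, δ)).2) :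
      S × Dart k t) = μ.vertexPerm k (μ.act a s, δ) := by
    intro s δ
    simp only [Monodromy.vertexPerm_apply]
    cases δ <;> simp [vertexFun, μ.act_e, μ.act_d]
  obtain ⟨⟨s, δ⟩, _ | _⟩ := ω
  · have h2 : μ.doubleAct k a ((μ.vertexPerm k).symm (s, δ), false) =
        ((μ.vertexPerm k).symm (μ.act a s, δ), false) := by
      refine congrArg (fun z => (z, false)) ?_
      rw [Equiv.eq_symm_apply]
      refine (h _ _).symm.trans ?_
      change ((μ.act a (μ.vertexPerm k ((μ.vertexPerm k).symm (s, δ))).1,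
        (μ.vertexPerm k ((μ.vertexPerm k).symm (s, δ))).2) : S × Dart k t) = (μ.act a s, δ)
      rw [Equiv.apply_symm_apply]
    exact h2
  · exact congrArg (fun z => (z, true)) (h s δ)

/-- The group generated by the two canonical rotations of the doubled covering. -/
def rotations : Subgroup (Equiv.Perm ((S × Dart k t) × Bool)) :=
  Subgroup.closure {doublePerm (μ.edgePerm k), doublePerm (μ.vertexPerm k)}

/-- The group generated by the three canonical reflections of the doubled covering. -/
def reflections : Subgroup (Equiv.Perm ((S × Dart k t) × Bool)) :=
  Subgroup.closure {swapPerm _, swapPerm _ * doublePerm (μ.edgePerm k),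
    swapPerm _ * doublePerm (μ.vertexPerm k)}

theorem doubleAct_comm (a : A) : ∀ h ∈ μ.reflections k, ∀ ω,
    μ.doubleAct k a (h ω) = h (μ.doubleAct k a ω) := by
  have hs : ∀ ω, μ.doubleAct k a (swapPerm _ ω) = swapPerm _ (μ.doubleAct k a ω) :=
    fun _ => rfl
  intro h hh
  induction hh using Subgroup.closure_induction with
  | mem h hh =>
    rcases hh with rfl | rfl | rfl
    · exact hs
    · intro ω
      rw [Equiv.Perm.mul_apply, hs, doubleAct_edgePerm, Equiv.Perm.mul_apply]
    · intro ω
      rw [Equiv.Perm.mul_apply, hs, doubleAct_vertexPerm, Equiv.Perm.mul_apply]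
  | one => exact fun _ => rfl
  | mul g h _ _ hg hh =>
    intro ω
    rw [Equiv.Perm.mul_apply, hg, hh, Equiv.Perm.mul_apply]
  | inv g _ hg =>
    intro ω
    rw [Equiv.Perm.eq_inv_iff_eq, ← hg, ← Equiv.Perm.mul_apply g, mul_inv_cancel,
      Equiv.Perm.one_apply]

/-- Each generator is the effect of walking from `l` to the corresponding end, going around it and
returning by the same path. Paths are words in the rotations, so these are conjugates. -/
theorem exists_rotation (h : Equiv.Perm S) (hh : h ∈ Subgroup.closure {μ.d, μ.e, μ.c₁}) :
    ∀ s, ∃ g ∈ μ.rotations k, g ((s, .l), true) = ((h s, .l), true) := by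
  have hx : doublePerm (μ.edgePerm k) ∈ μ.rotations k := Subgroup.subset_closure (Or.inl rfl)
  have hy : doublePerm (μ.vertexPerm k) ∈ μ.rotations k := Subgroup.subset_closure (Or.inr rfl)
  set X := doublePerm (μ.edgePerm k) with hX
  set Y := doublePerm (μ.vertexPerm k) with hY
  have conj : ∀ g ∈ μ.rotations k, ∀ p ∈ μ.rotations k, ∀ (ω ω' : (S × Dart k t) × Bool),
      g (p ω) = p ω' → ∃ g ∈ μ.rotations k, g ω = ω' := by
    intro g hg p hp ω ω' h
    refine ⟨p⁻¹ * g * p, mul_mem (mul_mem (inv_mem hp) hg) hp, ?_⟩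
    rw [Equiv.Perm.mul_apply, Equiv.Perm.mul_apply, h, ← Equiv.Perm.mul_apply, inv_mul_cancel,
      Equiv.Perm.one_apply]
  induction hh using Subgroup.closure_induction with
  | mem h hh =>
    rcases hh with rfl | rfl | rfl <;> intro s
    · exact ⟨Y, hy, rfl⟩
    · cases t with
      | half =>
        refine conj X hx (Y⁻¹ * X) (mul_mem (inv_mem hy) hx) _ _ ?_
        simp [hX, hY, Monodromy.edgePerm_apply, Monodromy.vertexPerm_symm_apply, edgeFun,
          vertexFun]
      | leaf =>
        refine conj Y hy (X * Y⁻¹ * X) (mul_mem (mul_mem hx (inv_mem hy)) hx) _ _ ?_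
        simp [hX, hY, Monodromy.edgePerm_apply, Monodromy.vertexPerm_apply,
          Monodromy.vertexPerm_symm_apply, edgeFun, vertexFun]
      | loop =>
        refine conj (Y * X * Y) (mul_mem (mul_mem hy hx) hy) (X * Y⁻¹ * X)
          (mul_mem (mul_mem hx (inv_mem hy)) hx) _ _ ?_
        simp [hX, hY, Monodromy.edgePerm_apply, Monodromy.vertexPerm_apply,
          Monodromy.vertexPerm_symm_apply, edgeFun, vertexFun]
    · refine conj X hx (Y * X * Y * X) (mul_mem (mul_mem (mul_mem hy hx) hy) hx) _ _ ?_
      simp [hX, hY, Monodromy.edgePerm_apply, Monodromy.vertexPerm_apply, edgeFun, vertexFun]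
  | one => exact fun s => ⟨1, one_mem _, rfl⟩
  | mul g h _ _ hg hh =>
    intro s
    obtain ⟨h', hh', e₁⟩ := hh s
    obtain ⟨g', hg', e₂⟩ := hg (h s)
    exact ⟨g' * h', mul_mem hg' hh', by rw [Equiv.Perm.mul_apply, e₁, e₂]; rfl⟩
  | inv g _ hg =>
    intro s
    obtain ⟨g', hg', e₁⟩ := hg (g⁻¹ s)
    refine ⟨g'⁻¹, inv_mem hg', ?_⟩
    rw [Equiv.Perm.inv_eq_iff_eq, e₁, ← Equiv.Perm.mul_apply, mul_inv_cancel,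
      Equiv.Perm.one_apply]

/-- Only the two kinds of valency-one vertex can be fixed by `y`. The word `yxyx` leads from `l` to
the free edge `mid 0`, while from the other leaf, or in the mirror copy where left and right turns
are exchanged, it generally ends at a dart that is not free. -/
theorem eq_of_fixed (ω : (S × Dart k t) × Bool) (hy : doublePerm (μ.vertexPerm k) ω = ω)
    (hx : doublePerm (μ.edgePerm k) ((doublePerm (μ.vertexPerm k) * doublePerm (μ.edgePerm k) *
      doublePerm (μ.vertexPerm k) * doublePerm (μ.edgePerm k)) ω) =
      (doublePerm (μ.vertexPerm k) * doublePerm (μ.edgePerm k) *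
      doublePerm (μ.vertexPerm k) * doublePerm (μ.edgePerm k)) ω) :
    ∃ s, μ.d s = s ∧ μ.c₁ s = s ∧ ω = ((s, .l), true) := by
  have h2 := μ.e_c₂
  obtain ⟨⟨s, δ⟩, b⟩ := ω
  cases b
  · rw [doublePerm_false, Prod.mk.injEq, Equiv.symm_apply_eq, Monodromy.vertexPerm_apply] at hy
    exfalso
    cases δ with
    | l =>
      cases t <;> simp [Monodromy.edgePerm_symm_apply, Monodromy.vertexPerm_symm_apply, edgeFun,
        vertexFun] at hx
    | leaf =>
      simp [vertexFun] at hy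
      -- The mirrored walk from the leaf ends at `out 0`, which is a free edge exactly when `k = 0`.
      -- That coincidence is ruled out by `e_c₂`.
      by_cases hk : 0 < k
      · simp [Monodromy.edgePerm_symm_apply, Monodromy.vertexPerm_symm_apply, edgeFun,
          vertexFun, hk] at hx
      · simp [Monodromy.edgePerm_symm_apply, Monodromy.vertexPerm_symm_apply, edgeFun,
          vertexFun, hk] at hx
        exact h2 s hy.symm hx
    | _ => simp [vertexFun] at hy
  · rw [doublePerm_true, Prod.mk.injEq, Monodromy.vertexPerm_apply] at hy
    cases δ with
    | l =>
      simp [Monodromy.edgePerm_apply, Monodromy.vertexPerm_apply, edgeFun, vertexFun] at hx hy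
      exact ⟨s, hy, hx, rfl⟩
    | leaf =>
      simp [Monodromy.edgePerm_apply, Monodromy.vertexPerm_apply, edgeFun, vertexFun] at hx
    | _ => simp [vertexFun] at hy

theorem realises : Realises A (μ.rotations k) (μ.reflections k) := by
  refine ⟨μ.doubleAct k, ((μ.base, .l), true), ?_, μ.doubleAct_comm k, ?_, ?_⟩
  · intro a ha
    rw [doubleAct_apply, Prod.mk.injEq, Prod.mk.injEq] at ha
    exact μ.free a ha.1.1
  · intro a
    obtain ⟨h, hh, e⟩ := μ.conn a
    obtain ⟨g, hg, e'⟩ := μ.exists_rotation k h hh μ.base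
    exact ⟨g, hg, by rw [e', e, doubleAct_apply]⟩
  · intro ω hω
    have hx : doublePerm (μ.edgePerm k) ∈ μ.rotations k := Subgroup.subset_closure (Or.inl rfl)
    have hy : doublePerm (μ.vertexPerm k) ∈ μ.rotations k := Subgroup.subset_closure (Or.inr rfl)
    have hp := mul_mem (mul_mem (mul_mem hy hx) hy) hx
    obtain ⟨s, h₁, h₂, rfl⟩ := μ.eq_of_fixed k ω
      (hω _ hy (by simp [Monodromy.vertexPerm_apply, vertexFun, μ.d_base])) (by
        -- With `p = yxyx`, the conjugate `p⁻¹ x p` fixes the base dart because `c₁` fixes the base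
        -- sheet; hence it must fix `ω` too.
        have := hω _ (mul_mem (mul_mem (inv_mem hp) hx) hp) (by
          rw [Equiv.Perm.mul_apply, Equiv.Perm.mul_apply, Equiv.Perm.inv_eq_iff_eq]
          simp [Monodromy.edgePerm_apply, Monodromy.vertexPerm_apply, edgeFun, vertexFun,
            μ.c₁_base])
        rwa [Equiv.Perm.mul_apply, Equiv.Perm.mul_apply, Equiv.Perm.inv_eq_iff_eq] at this)
    obtain ⟨a, rfl⟩ := μ.eq_act s h₁ h₂
    exact ⟨a, rfl⟩

end RigidMonodromy

/-! ### Rigid monodromy from voltages -/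

/-- A permutation of order dividing three. -/
def permOfCube {B : Type u} (f : B → B) (h : ∀ b, f (f (f b)) = b) : Equiv.Perm B :=
  ⟨f, fun b => f (f b), h, h⟩

/-- The covering of a permutation `σ` by voltages `ν`. -/
def voltagePerm {A : Type u} [Group A] {B : Type v} (σ : Equiv.Perm B) (ν : B → A) :
    Equiv.Perm (A × B) where
  toFun s := (s.1 * ν s.2, σ s.2)
  invFun s := (s.1 * (ν (σ.symm s.2))⁻¹, σ.symm s.2)
  left_inv := by rintro ⟨g, b⟩; simp
  right_inv := by rintro ⟨g, b⟩; simp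

theorem voltagePerm_apply {A : Type u} [Group A] {B : Type v} (σ : Equiv.Perm B) (ν : B → A)
    (g : A) (b : B) : voltagePerm σ ν (g, b) = (g * ν b, σ b) := rfl

theorem voltagePerm_one_pow {A : Type u} [Group A] {B : Type v} {σ : Equiv.Perm B} {n : ℕ}
    (h : σ ^ n = 1) : voltagePerm σ (1 : B → A) ^ n = 1 := by
  have : ∀ m (g : A) b, (voltagePerm σ (1 : B → A) ^ m) (g, b) = (g, (σ ^ m) b) := by
    intro m
    induction m with
    | zero => intro g b; rfl
    | succ m ih =>
      intro g b
      rw [pow_succ, Equiv.Perm.mul_apply, voltagePerm_apply, ih, pow_succ, Equiv.Perm.mul_apply]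
      simp
  ext1 ⟨g, b⟩
  rw [this, h]
  rfl

/-- Right multiplication by voltages commutes with left translation by `A`. Only `c` carries
voltages; `ν_c` makes its lift an involution, and together with `cde` and `ν_de` this makes the lift
of `cde` one, as `c₂` requires. The hypothesis `conn` expresses, through invariant predicates, that
some walk from the base has total voltage `a i`. -/
theorem nonempty_rigidMonodromy_of_voltage {A : Type u} [Group A] {B : Type v} {t : EndKind}
    (d e c : Equiv.Perm B) (ν : B → A) (b₀ : B) (a : ℕ → A) (ha : Function.Surjective a)
    (d_pow : d ^ 3 = 1) (e_pow : e ^ t.period = 1) (c_c : ∀ b, c (c b) = b)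
    (cde : ∀ b, c (d (e (c (d (e b))))) = b)
    (ν_c : ∀ b, ν (c b) = (ν b)⁻¹) (ν_de : ∀ b, ν (d (e b)) = ν b) (ν_base : ν b₀ = 1)
    (d_base : d b₀ = b₀) (c_base : c b₀ = b₀) (eq_base : ∀ b, d b = b → c b = b → b = b₀)
    (e_ne : ∀ b, e b ≠ b)
    (conn : ∀ P : A × B → Prop, (∀ g b, P (g, d b) ↔ P (g, b)) → (∀ g b, P (g, e b) ↔ P (g, b)) →
      (∀ g b, P (g * ν b, c b) ↔ P (g, b)) → ∀ g i, P (g * a i, b₀) ↔ P (g, b₀)) :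
    Nonempty (RigidMonodromy A (A × B) t) := by
  let D := voltagePerm d (1 : B → A)
  let E := voltagePerm e (1 : B → A)
  let C := voltagePerm c ν
  have hD : ∀ g b, D (g, b) = (g, d b) := fun g b => by simp [D, voltagePerm_apply]
  have hE : ∀ g b, E (g, b) = (g, e b) := fun g b => by simp [E, voltagePerm_apply]
  have hC : ∀ g b, C (g, b) = (g * ν b, c b) := fun _ _ => rfl
  have hCC : ∀ s, C (C s) = s := by
    rintro ⟨g, b⟩
    rw [hC, hC, ν_c, c_c, mul_inv_cancel_right]
  have hCDE : ∀ s, C (D (E (C (D (E s))))) = s := by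
    rintro ⟨g, b⟩
    have h1 : d (e (c (d (e b)))) = c b := by rw [← cde b, c_c, cde]
    rw [hE, hD, hC, hE, hD, hC, h1, c_c, ν_c, ν_de, mul_inv_cancel_right]
  have hDE : ∀ s, (D * E)⁻¹ (C s) = C (D (E s)) := by
    intro s
    rw [Equiv.Perm.inv_eq_iff_eq, Equiv.Perm.mul_apply]
    apply C.injective
    rw [hCC, hCDE]
  let act : A →* Equiv.Perm (A × B) :=
    { toFun := fun a => (Equiv.mulLeft a).prodCongr (Equiv.refl B)
      map_one' := by ext1 ⟨g, b⟩; simp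
      map_mul' := fun a a' => by ext1 ⟨g, b⟩; simp [mul_assoc] }
  have hact : ∀ a g b, act a (g, b) = (a * g, b) := fun _ _ _ => rfl
  have act_d : ∀ a s, act a (D s) = D (act a s) := by
    rintro a ⟨g, b⟩
    rw [hD, hact, hact, hD]
  have act_e : ∀ a s, act a (E s) = E (act a s) := by
    rintro a ⟨g, b⟩
    rw [hE, hact, hact, hE]
  have act_c : ∀ a s, act a (C s) = C (act a s) := by
    rintro a ⟨g, b⟩
    rw [hC, hact, hact, hC, mul_assoc]
  let μ : Monodromy (A × B) t :=
    { d := D, e := E, c₁ := C, c₂ := (D * E)⁻¹ * C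
      d_pow := voltagePerm_one_pow d_pow
      e_pow := voltagePerm_one_pow e_pow
      c₁_sq := by ext1 s; exact hCC s
      c₂_sq := by
        ext1 s
        rw [sq, Equiv.Perm.mul_apply, Equiv.Perm.mul_apply, Equiv.Perm.mul_apply, hDE, hDE, hCDE,
          Equiv.Perm.one_apply]
      prod_eq := by
        intro s
        rw [Equiv.Perm.mul_apply, hCC, mul_inv_rev, Equiv.Perm.mul_apply]
        simp }
  refine ⟨{ μ with
    act := act
    base := (1, b₀)
    act_d := act_d
    act_e := act_e
    act_c₁ := act_c
    act_c₂ := ?_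
    free := ?_
    d_base := ?_
    c₁_base := ?_
    eq_act := ?_
    e_c₂ := ?_
    conn := ?_ }⟩
  · intro a s
    change act a ((D * E)⁻¹ (C s)) = (D * E)⁻¹ (C (act a s))
    rw [hDE, hDE, act_c, act_d, act_e]
  · intro a h
    rw [hact, mul_one] at h
    exact congrArg Prod.fst h
  · change D (1, b₀) = (1, b₀)
    rw [hD, d_base]
  · change C (1, b₀) = (1, b₀)
    rw [hC, ν_base, c_base, mul_one]
  · rintro ⟨g, b⟩ h1 h2
    change D (g, b) = (g, b) at h1
    change C (g, b) = (g, b) at h2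
    rw [hD] at h1
    rw [hC] at h2
    refine ⟨g, ?_⟩
    rw [hact, mul_one, eq_base b (congrArg Prod.snd h1) (congrArg Prod.snd h2)]
  · rintro ⟨g, b⟩ h
    change E (g, b) = (g, b) at h
    rw [hE] at h
    exact absurd (congrArg Prod.snd h) (e_ne b)
  · intro a'
    change ∃ h ∈ Subgroup.closure {D, E, C}, h (1, b₀) = act a' (1, b₀)
    -- Reachability from the base is an invariant predicate, so `conn` makes every translate of the
    -- base reachable.
    let P : A × B → Prop := fun s => ∃ h ∈ Subgroup.closure {D, E, C}, h (1, b₀) = s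
    have hP : ∀ k ∈ Subgroup.closure {D, E, C}, ∀ s, P (k s) ↔ P s := by
      intro k hk s
      constructor
      · rintro ⟨h, hh, e⟩
        exact ⟨k⁻¹ * h, mul_mem (inv_mem hk) hh, by
          rw [Equiv.Perm.mul_apply, e, Equiv.Perm.inv_eq_iff_eq]⟩
      · rintro ⟨h, hh, e⟩
        exact ⟨k * h, mul_mem hk hh, by rw [Equiv.Perm.mul_apply, e]⟩
    obtain ⟨i, rfl⟩ := ha a'
    have := conn P
      (fun g b => by rw [← hD]; exact hP D (Subgroup.subset_closure (Or.inl rfl)) _)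
      (fun g b => by rw [← hE]; exact hP E (Subgroup.subset_closure (Or.inr (Or.inl rfl))) _)
      (fun g b => by rw [← hC]; exact hP C (Subgroup.subset_closure (Or.inr (Or.inr rfl))) _) 1 i
    rw [hact, mul_one]
    rw [one_mul] at this
    exact this.2 ⟨1, one_mem _, rfl⟩

/-! ### Sheets for an end of period three -/

/-- Sheets permuted by two elements of order three: a component of six points, and a sequence of
components of three points. -/
inductive TriSheet : Type
  | e0 | e1 | e2 | e3 | e4 | e5
  | r0 (i : ℕ) (b : Bool) | r1 (i : ℕ) (b : Bool) | r2 (i : ℕ) (b : Bool)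

namespace TriSheet

/-- The monodromy around the leaf. -/
def dFun : TriSheet → TriSheet
  | e0 => e0 | e1 => e2 | e2 => e3 | e3 => e1 | e4 => e4 | e5 => e5
  | r0 i b => r1 i b | r1 i b => r2 i b | r2 i b => r0 i b

/-- The monodromy around the first branch. -/
def eFun : TriSheet → TriSheet
  | e0 => e2 | e1 => e0 | e2 => e1 | e3 => e4 | e4 => e5 | e5 => e3
  | r0 i b => r2 i b | r1 i b => r0 i b | r2 i b => r1 i b

/-- The monodromy around a free edge. -/
def cFun : TriSheet → TriSheet
  | e0 => e0 | e1 => e3 | e2 => r0 0 false | e3 => e1 | e4 => e5 | e5 => e4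
  | r0 0 false => e2
  | r0 (i + 1) false => r1 i true
  | r0 i true => r1 i false
  | r1 i false => r0 i true
  | r1 i true => r0 (i + 1) false
  | r2 i b => r2 i (!b)

/-- The voltages on the free edge. -/
def voltage {A : Type u} [Group A] (a : ℕ → A) : TriSheet → A
  | r2 i false => a i
  | r2 i true => (a i)⁻¹
  | _ => 1

theorem dFun_dFun_dFun (b : TriSheet) : dFun (dFun (dFun b)) = b := by cases b <;> rfl

theorem eFun_eFun_eFun (b : TriSheet) : eFun (eFun (eFun b)) = b := by cases b <;> rfl

theorem cFun_cFun (b : TriSheet) : cFun (cFun b) = b := by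
  cases b with
  | r0 i b => cases b <;> cases i <;> rfl
  | r1 i b => cases b <;> cases i <;> rfl
  | r2 i b => cases b <;> rfl
  | _ => rfl

/-- On the six-point component `de` is the five-cycle `(e0 e3 e4 e5 e1)`, which `c` reflects about
`e0`, and it fixes `e2`. On the three-point components `e = d⁻¹`, so `de` is trivial. Joining fixed
points of `de` by `c` is unrestricted, and this builds the chain. -/
theorem cFun_dFun_eFun (b : TriSheet) :
    cFun (dFun (eFun (cFun (dFun (eFun b))))) = b := by
  cases b with
  | r0 i b => cases b <;> cases i <;> rfl
  | r1 i b => cases b <;> cases i <;> rfl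
  | r2 i b => cases b <;> rfl
  | _ => rfl

end TriSheet

/-- The only fixed points of `d` are `e0`, `e4` and `e5`, and `c` exchanges the last two. The points
`r0`, `r1` link the chain, leaving the pair of points `r2 i` to carry the voltage `a i`. -/
theorem nonempty_rigidMonodromy_of_period_three (A : Type u) [Group A] [Countable A]
    {t : EndKind} (ht : t.period = 3) : Nonempty (RigidMonodromy A (A × TriSheet) t) := by
  obtain ⟨a, ha⟩ := exists_surjective_nat A
  refine nonempty_rigidMonodromy_of_voltage (permOfCube _ TriSheet.dFun_dFun_dFun)
    (permOfCube _ TriSheet.eFun_eFun_eFun)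
    (Function.Involutive.toPerm _ TriSheet.cFun_cFun) (TriSheet.voltage a) .e0 a ha ?_ ?_
    TriSheet.cFun_cFun TriSheet.cFun_dFun_eFun ?_ ?_ rfl rfl rfl ?_ ?_ ?_
  · ext1 b; exact TriSheet.dFun_dFun_dFun b
  · rw [ht]; ext1 b; exact TriSheet.eFun_eFun_eFun b
  · intro b
    change TriSheet.voltage a (TriSheet.cFun b) = _
    rcases b with _ | _ | _ | _ | _ | _ | ⟨_ | i, _ | _⟩ | ⟨i, _ | _⟩ | ⟨i, _ | _⟩ <;>
      simp [TriSheet.voltage, TriSheet.cFun]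
  · intro b
    change TriSheet.voltage a (TriSheet.dFun (TriSheet.eFun b)) = _
    cases b <;> rfl
  · intro b h1 h2
    change TriSheet.dFun b = b at h1
    change TriSheet.cFun b = b at h2
    cases b <;> simp_all [TriSheet.dFun, TriSheet.cFun]
  · intro b h
    change TriSheet.eFun b = b at h
    cases b <;> simp [TriSheet.eFun] at h
  · intro P hd he hc
    change ∀ g b, P (g, TriSheet.dFun b) ↔ _ at hd
    change ∀ g b, P (g, TriSheet.eFun b) ↔ _ at he
    change ∀ g b, P (g * TriSheet.voltage a b, TriSheet.cFun b) ↔ _ at hc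
    have h01 : ∀ g i b, P (g, .r1 i b) ↔ P (g, .r0 i b) := fun g i b => hd g (.r0 i b)
    have h02 : ∀ g i b, P (g, .r2 i b) ↔ P (g, .r0 i b) := fun g i b => he g (.r0 i b)
    have hft : ∀ g i, P (g, .r0 i true) ↔ P (g, .r0 i false) := by
      intro g i
      have := hc g (.r1 i false)
      simp only [TriSheet.voltage, TriSheet.cFun, mul_one] at this
      rw [this, h01]
    have hff : ∀ g i, P (g, .r0 i false) ↔ P (g, .r0 0 false) := by
      intro g i
      induction i with
      | zero => rfl
      | succ i ih =>
        have := hc g (.r1 i true)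
        simp only [TriSheet.voltage, TriSheet.cFun, mul_one] at this
        rw [this, h01, hft, ih]
    have hbase : ∀ g, P (g, .e0) ↔ P (g, .r0 0 false) := by
      intro g
      have h1 := hc g .e2
      simp only [TriSheet.voltage, TriSheet.cFun, mul_one] at h1
      rw [h1]
      exact (he g .e0).symm
    intro g i
    -- The closed walk: out along the chain, across the edge of voltage `a i` between the two copies
    -- of `r2 i`, and back along edges of trivial voltage.
    have := hc g (.r2 i false)
    simp only [TriSheet.voltage, TriSheet.cFun, Bool.not_false] at this
    rw [hbase, hbase, ← hff _ i, ← hft, ← h02, this, h02, hff]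

/-! ### Sheets for an end of period two -/

/-- Sheets permuted by elements of orders two and three: a component of four points, and a
sequence of components of six points. -/
inductive BiSheet : Type
  | e0 | e1 | e2 | e3
  | r0 (i : ℕ) (b : Bool) | r1 (i : ℕ) (b : Bool) | r2 (i : ℕ) (b : Bool)
  | r3 (i : ℕ) (b : Bool) | r4 (i : ℕ) (b : Bool) | r5 (i : ℕ) (b : Bool)

namespace BiSheet

/-- The monodromy around the leaf. -/
def dFun : BiSheet → BiSheet
  | e0 => e0 | e1 => e2 | e2 => e3 | e3 => e1
  | r0 i b => r1 i b | r1 i b => r2 i b | r2 i b => r0 i b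
  | r3 i b => r4 i b | r4 i b => r5 i b | r5 i b => r3 i b

/-- The monodromy around the first branch. -/
def eFun : BiSheet → BiSheet
  | e0 => e1 | e1 => e0 | e2 => e3 | e3 => e2
  | r0 i b => r1 i b | r1 i b => r0 i b | r2 i b => r5 i b
  | r3 i b => r4 i b | r4 i b => r3 i b | r5 i b => r2 i b

/-- The monodromy around a free edge. -/
def cFun : BiSheet → BiSheet
  | e0 => e0 | e1 => e2 | e2 => e1 | e3 => r1 0 false
  | r1 0 false => e3
  | r1 (i + 1) false => r4 i true
  | r1 i true => r4 i false
  | r4 i false => r1 i true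
  | r4 i true => r1 (i + 1) false
  | r0 i b => r0 i (!b)
  | r2 i b => r5 i (!b)
  | r3 i b => r3 i (!b)
  | r5 i b => r2 i (!b)

/-- The voltages on the free edge. -/
def voltage {A : Type u} [Group A] (a : ℕ → A) : BiSheet → A
  | r0 i b => if b then (a i)⁻¹ else a i
  | r2 i b => if b then (a i)⁻¹ else a i
  | r3 i b => if b then (a i)⁻¹ else a i
  | r5 i b => if b then (a i)⁻¹ else a i
  | _ => 1

theorem dFun_dFun_dFun (b : BiSheet) : dFun (dFun (dFun b)) = b := by cases b <;> rfl

theorem eFun_eFun (b : BiSheet) : eFun (eFun b) = b := by cases b <;> rfl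

theorem cFun_cFun (b : BiSheet) : cFun (cFun b) = b := by
  cases b with
  | r1 i b => cases b <;> cases i <;> rfl
  | r4 i b => cases b <;> cases i <;> rfl
  | _ => simp [cFun]

/-- On the four-point component `de` is the three-cycle `(e0 e2 e1)`, reflected by `c`, and fixes
`e3`. On a six-point component it is the four-cycle `(r0 r2 r3 r5)` and fixes `r1`, `r4`, which are
used as links. The involution `c` matches the four-cycles of paired components in opposite
directions. -/
theorem cFun_dFun_eFun (b : BiSheet) :
    cFun (dFun (eFun (cFun (dFun (eFun b))))) = b := by
  cases b with
  | r1 i b => cases b <;> cases i <;> rfl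
  | r4 i b => cases b <;> cases i <;> rfl
  | _ => simp [cFun, dFun, eFun]

end BiSheet

/-- Here `e0` is the only fixed point of `d`. Since `de` must preserve voltages, `a i` is placed on
a whole four-cycle and its inverse on the paired one. -/
theorem nonempty_rigidMonodromy_of_period_two (A : Type u) [Group A] [Countable A]
    {t : EndKind} (ht : t.period = 2) : Nonempty (RigidMonodromy A (A × BiSheet) t) := by
  obtain ⟨a, ha⟩ := exists_surjective_nat A
  refine nonempty_rigidMonodromy_of_voltage (permOfCube _ BiSheet.dFun_dFun_dFun)
    (Function.Involutive.toPerm _ BiSheet.eFun_eFun)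
    (Function.Involutive.toPerm _ BiSheet.cFun_cFun) (BiSheet.voltage a) .e0 a ha ?_ ?_
    BiSheet.cFun_cFun BiSheet.cFun_dFun_eFun ?_ ?_ rfl rfl rfl ?_ ?_ ?_
  · ext1 b; exact BiSheet.dFun_dFun_dFun b
  · rw [ht]; ext1 b; exact BiSheet.eFun_eFun b
  · intro b
    change BiSheet.voltage a (BiSheet.cFun b) = _
    cases b with
    | r1 i b => cases b <;> cases i <;> simp [BiSheet.voltage, BiSheet.cFun]
    | r4 i b => cases b <;> simp [BiSheet.voltage, BiSheet.cFun]
    | r0 i b => cases b <;> simp [BiSheet.voltage, BiSheet.cFun]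
    | r2 i b => cases b <;> simp [BiSheet.voltage, BiSheet.cFun]
    | r3 i b => cases b <;> simp [BiSheet.voltage, BiSheet.cFun]
    | r5 i b => cases b <;> simp [BiSheet.voltage, BiSheet.cFun]
    | _ => simp [BiSheet.voltage, BiSheet.cFun]
  · intro b
    change BiSheet.voltage a (BiSheet.dFun (BiSheet.eFun b)) = _
    cases b <;> rfl
  · intro b h1 h2
    change BiSheet.dFun b = b at h1
    cases b <;> simp_all [BiSheet.dFun]
  · intro b h
    change BiSheet.eFun b = b at h
    cases b <;> simp [BiSheet.eFun] at h
  · intro P hd he hc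
    change ∀ g b, P (g, BiSheet.dFun b) ↔ _ at hd
    change ∀ g b, P (g, BiSheet.eFun b) ↔ _ at he
    change ∀ g b, P (g * BiSheet.voltage a b, BiSheet.cFun b) ↔ _ at hc
    have h10 : ∀ g i b, P (g, .r1 i b) ↔ P (g, .r0 i b) := fun g i b => hd g (.r0 i b)
    have h40 : ∀ g i b, P (g, .r4 i b) ↔ P (g, .r0 i b) := fun g i b =>
      (hd g (.r4 i b)).symm.trans ((he g (.r2 i b)).trans (hd g (.r2 i b)).symm)
    have hft : ∀ g i, P (g, .r0 i true) ↔ P (g, .r0 i false) := by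
      intro g i
      have := hc g (.r4 i false)
      simp only [BiSheet.voltage, BiSheet.cFun, mul_one] at this
      rw [← h10, this, h40]
    have hff : ∀ g i, P (g, .r0 i false) ↔ P (g, .r0 0 false) := by
      intro g i
      induction i with
      | zero => rfl
      | succ i ih =>
        have := hc g (.r4 i true)
        simp only [BiSheet.voltage, BiSheet.cFun, mul_one] at this
        rw [← h10, this, h40, hft, ih]
    have hbase : ∀ g, P (g, .e0) ↔ P (g, .r0 0 false) := by
      intro g
      have h1 := hc g .e3
      simp only [BiSheet.voltage, BiSheet.cFun, mul_one] at h1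
      rw [← h10, h1]
      exact (he g .e0).symm.trans (hd g .e3)
    intro g i
    have := hc g (.r0 i false)
    simp only [BiSheet.voltage, BiSheet.cFun, Bool.not_false] at this
    rw [hbase, hbase, ← hff _ i, ← hft]
    exact this.trans (hff g i)

/-! ### Triangle groups -/

/-- The outer face has length `7 + 3k + weight`, so the residue of `n - 7` modulo three selects the
end and the quotient gives the length of the path. -/
theorem exists_reflections_realises (A : Type u) [Group A] [Countable A] (n : ℕ) (hn : 7 ≤ n) :
    ∃ (T : Type u) (α β γ : Equiv.Perm T), α ^ 2 = 1 ∧ β ^ 2 = 1 ∧ γ ^ 2 = 1 ∧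
      (α * β) ^ 2 = 1 ∧ (α * γ) ^ 3 = 1 ∧ (β * γ) ^ n = 1 ∧
      Realises A (Subgroup.closure {α * β, α * γ}) (Subgroup.closure {α, β, γ}) := by
  have key : ∀ (S : Type u) (t : EndKind) (k : ℕ), n = 7 + 3 * k + t.weight →
      Nonempty (RigidMonodromy A S t) → ∃ (T : Type u) (α β γ : Equiv.Perm T),
      α ^ 2 = 1 ∧ β ^ 2 = 1 ∧ γ ^ 2 = 1 ∧
      (α * β) ^ 2 = 1 ∧ (α * γ) ^ 3 = 1 ∧ (β * γ) ^ n = 1 ∧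
      Realises A (Subgroup.closure {α * β, α * γ}) (Subgroup.closure {α, β, γ}) := by
    rintro S t k hk ⟨μ⟩
    refine ⟨(S × Dart k t) × Bool, swapPerm _, swapPerm _ * doublePerm (μ.edgePerm k),
      swapPerm _ * doublePerm (μ.vertexPerm k), swapPerm_sq, swapPerm_mul_doublePerm_sq,
      swapPerm_mul_doublePerm_sq, ?_, ?_, doublePerm_mul_pow (μ.edgePerm_sq k)
        (μ.facePerm_pow k n hk), ?_⟩
    · rw [swapPerm_mul_swapPerm_mul]
      exact doublePerm_pow (μ.edgePerm_sq k)
    · rw [swapPerm_mul_swapPerm_mul]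
      exact doublePerm_pow (μ.vertexPerm_cube k)
    · rw [swapPerm_mul_swapPerm_mul, swapPerm_mul_swapPerm_mul]
      exact μ.realises k
  have hk := Nat.div_add_mod (n - 7) 3
  have hlt := Nat.mod_lt (n - 7) (by norm_num : 3 > 0)
  obtain h | h | h : (n - 7) % 3 = 0 ∨ (n - 7) % 3 = 1 ∨ (n - 7) % 3 = 2 := by omega
  · exact key _ .half ((n - 7) / 3) (by simp only [EndKind.weight]; omega)
      (nonempty_rigidMonodromy_of_period_two A rfl)
  · exact key _ .leaf ((n - 7) / 3) (by simp only [EndKind.weight]; omega)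
      (nonempty_rigidMonodromy_of_period_three A rfl)
  · exact key _ .loop ((n - 7) / 3) (by simp only [EndKind.weight]; omega)
      (nonempty_rigidMonodromy_of_period_three A rfl)

/-- `A` is isomorphic to the quotient by `M` of the normalizer of `M`, for some `M ≤ Γ`. -/
def IsNormalizerQuotient (A : Type u) [Group A] (Γ : Type v) [Group Γ] : Prop :=
  ∃ M : Subgroup Γ, Nonempty (A ≃* (Subgroup.normalizer (M : Set Γ) ⧸
    M.subgroupOf (Subgroup.normalizer (M : Set Γ))))

/-! ### Transfer to triangle groups with arbitrary order of the periods -/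

theorem lift_powRel {α : Type*} {G : Type*} [Group G] (f : α → G) {g : FreeGroup α} {n : ℕ∞}
    (h : PowEqOne (FreeGroup.lift f g) n) : ∀ t ∈ powRel g n, FreeGroup.lift f t = 1 := by
  rintro _ ⟨k, hk, rfl⟩
  rw [map_pow, h k hk]

theorem Realises.isNormalizerQuotient {A : Type u} [Group A] {T : Type v}
    {H K : Subgroup (Equiv.Perm T)} (h : Realises A H K) {p q r : ℕ∞} (R₀ R₁ R₂ : Equiv.Perm T)
    (h₀ : R₀ ^ 2 = 1) (h₁ : R₁ ^ 2 = 1) (h₂ : R₂ ^ 2 = 1) (hp : PowEqOne (R₁ * R₂) p)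
    (hq : PowEqOne (R₂ * R₀) q) (hr : PowEqOne (R₀ * R₁) r)
    (hH : H ≤ Subgroup.closure {R₁ * R₂, R₂ * R₀, R₀ * R₁}) (k₀ : R₀ ∈ K) (k₁ : R₁ ∈ K)
    (k₂ : R₂ ∈ K) :
    IsNormalizerQuotient A (TriangleGroup p q r) ∧
      IsNormalizerQuotient A (ExtTriangleGroup p q r) := by
  constructor
  · let f : TriGen → Equiv.Perm T := fun
      | .X => R₁ * R₂
      | .Y => R₂ * R₀
      | .Z => R₀ * R₁
    have hf : ∀ t ∈ triangleRels p q r, FreeGroup.lift f t = 1 := by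
      rintro t (((ht | ht) | ht) | rfl)
      · exact lift_powRel f (by rw [FreeGroup.lift_apply_of]; exact hp) t ht
      · exact lift_powRel f (by rw [FreeGroup.lift_apply_of]; exact hq) t ht
      · exact lift_powRel f (by rw [FreeGroup.lift_apply_of]; exact hr) t ht
      · simp only [map_mul, FreeGroup.lift_apply_of, f]
        rw [show R₁ * R₂ * (R₂ * R₀) * (R₀ * R₁) = R₁ * (R₂ ^ 2) * R₀ ^ 2 * R₁ by
          simp only [sq, mul_assoc], h₂, h₀, mul_one, mul_one, ← sq, h₁]
    have hof : ∀ i, PresentedGroup.toGroup hf (PresentedGroup.of i) = f i := fun i =>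
      PresentedGroup.toGroup.of hf
    refine h.exists_subgroup (PresentedGroup.toGroup hf) (hH.trans ?_)
      (PresentedGroup.hom_range_le _ _ ?_)
    · rw [Subgroup.closure_le]
      rintro _ (rfl | rfl | rfl)
      · exact ⟨_, hof .X⟩
      · exact ⟨_, hof .Y⟩
      · exact ⟨_, hof .Z⟩
    · rintro (_ | _ | _) <;> rw [hof]
      exacts [mul_mem k₁ k₂, mul_mem k₂ k₀, mul_mem k₀ k₁]
  · let f : RefGen → Equiv.Perm T := fun
      | .R₀ => R₀
      | .R₁ => R₁
      | .R₂ => R₂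
    have hf : ∀ t ∈ extTriangleRels p q r, FreeGroup.lift f t = 1 := by
      rintro t (((⟨i, rfl⟩ | ht) | ht) | ht)
      · cases i <;> simpa [f]
      · exact lift_powRel f (by simpa [f] using hp) t ht
      · exact lift_powRel f (by simpa [f] using hq) t ht
      · exact lift_powRel f (by simpa [f] using hr) t ht
    have hof : ∀ i, PresentedGroup.toGroup hf (PresentedGroup.of i) = f i := fun i =>
      PresentedGroup.toGroup.of hf
    refine h.exists_subgroup (PresentedGroup.toGroup hf) (hH.trans ?_)
      (PresentedGroup.hom_range_le _ _ ?_)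
    · have m₀ : R₀ ∈ (PresentedGroup.toGroup hf).range := ⟨_, hof .R₀⟩
      have m₁ : R₁ ∈ (PresentedGroup.toGroup hf).range := ⟨_, hof .R₁⟩
      have m₂ : R₂ ∈ (PresentedGroup.toGroup hf).range := ⟨_, hof .R₂⟩
      rw [Subgroup.closure_le]
      rintro _ (rfl | rfl | rfl)
      exacts [mul_mem m₁ m₂, mul_mem m₂ m₀, mul_mem m₀ m₁]
    · rintro (_ | _ | _) <;> rw [hof]
      exacts [k₀, k₁, k₂]

/-- The condition `m ≠ 0` matters in `ℕ∞`: a nonzero `m` times `∞` is `∞`, which imposes no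
relation, whereas `0 * ∞ = 0`. -/
theorem powEqOne_of_dvd {G : Type*} [Group G] {g : G} {m : ℕ} (h : g ^ m = 1) (hm : m ≠ 0)
    {n : ℕ∞} (hn : (m : ℕ∞) ∣ n) : PowEqOne g n := by
  rintro k rfl
  obtain ⟨c, hc⟩ := hn
  induction c using ENat.recTopCoe with
  | top =>
    rw [ENat.mul_top (by exact_mod_cast hm)] at hc
    exact absurd hc (ENat.natCast_ne_top k)
  | coe c =>
    have : k = m * c := by exact_mod_cast hc
    rw [this, pow_mul, h, one_pow]

theorem PowEqOne.swap {G : Type*} [Group G] {g h : G} (hg : g ^ 2 = 1) (hh : h ^ 2 = 1) {n : ℕ∞}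
    (hn : PowEqOne (g * h) n) : PowEqOne (h * g) n := by
  have : h * g = (g * h)⁻¹ := by
    rw [eq_comm, inv_eq_iff_mul_eq_one, show g * h * (h * g) = g * h ^ 2 * g by
      simp only [sq, mul_assoc], hh, mul_one, ← sq, hg]
  intro k hk
  rw [this, inv_pow, hn k hk, inv_one]

theorem eq_of_perm_two {X : Type*} {a b p q : X} (h : [a, b].Perm [p, q]) :
    (p = a ∧ q = b) ∨ (p = b ∧ q = a) := by
  have ha : a ∈ [p, q] := h.subset (by simp)
  simp only [List.mem_cons, List.not_mem_nil, or_false] at ha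
  rcases ha with rfl | rfl
  · exact Or.inl ⟨rfl, (List.singleton_perm_singleton.1 h.cons_inv).symm⟩
  · exact Or.inr ⟨(List.singleton_perm_singleton.1 (h.trans (List.Perm.swap _ _ _)).cons_inv).symm,
      rfl⟩

theorem eq_of_perm_three {X : Type*} {a b c p q r : X} (h : [a, b, c].Perm [p, q, r]) :
    (p = a ∧ q = b ∧ r = c) ∨ (p = a ∧ q = c ∧ r = b) ∨ (p = b ∧ q = a ∧ r = c) ∨
      (p = b ∧ q = c ∧ r = a) ∨ (p = c ∧ q = a ∧ r = b) ∨ (p = c ∧ q = b ∧ r = a) := by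
  have ha : a ∈ [p, q, r] := h.subset (by simp)
  simp only [List.mem_cons, List.not_mem_nil, or_false] at ha
  rcases ha with rfl | rfl | rfl
  · rcases eq_of_perm_two h.cons_inv with ⟨rfl, rfl⟩ | ⟨rfl, rfl⟩ <;> simp
  · rcases eq_of_perm_two (h.trans (List.Perm.swap _ _ _)).cons_inv with ⟨rfl, rfl⟩ | ⟨rfl, rfl⟩ <;>
      simp
  · rcases eq_of_perm_two (h.trans (((List.Perm.swap _ _ _).cons _).trans
      (List.Perm.swap _ _ _))).cons_inv with ⟨rfl, rfl⟩ | ⟨rfl, rfl⟩ <;> simp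

theorem isNormalizerQuotient_triangleGroup (A : Type u) [Group A] [Countable A]
    (p q r a b c : ℕ∞) (habc : [a, b, c].Perm [p, q, r]) (ha : 2 ∣ a) (hb : 3 ∣ b)
    (hc : 7 ≤ c) :
    IsNormalizerQuotient A (TriangleGroup p q r) ∧
      IsNormalizerQuotient A (ExtTriangleGroup p q r) := by
  -- If `c = ∞` no relation is imposed, so any finite `n ≥ 7` will do, and `7` is used.
  obtain ⟨n, hn, hnc⟩ : ∃ n : ℕ, 7 ≤ n ∧ ∀ k : ℕ, c = k → n = k := by
    induction c using ENat.recTopCoe with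
    | top => exact ⟨7, le_rfl, fun k hk => absurd hk.symm (ENat.natCast_ne_top k)⟩
    | coe c => exact ⟨c, by exact_mod_cast hc, fun k hk => by exact_mod_cast hk⟩
  obtain ⟨T, α, β, γ, hα, hβ, hγ, hαβ, hαγ, hβγ, hR⟩ := exists_reflections_realises A n hn
  have ab : PowEqOne (α * β) a := powEqOne_of_dvd hαβ two_ne_zero ha
  have ac : PowEqOne (α * γ) b := powEqOne_of_dvd hαγ three_ne_zero hb
  have bc : PowEqOne (β * γ) c := fun k hk => by rw [← hnc k hk, hβγ]
  have kα : α ∈ Subgroup.closure {α, β, γ} := Subgroup.subset_closure (by simp)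
  have kβ : β ∈ Subgroup.closure {α, β, γ} := Subgroup.subset_closure (by simp)
  have kγ : γ ∈ Subgroup.closure {α, β, γ} := Subgroup.subset_closure (by simp)
  have inv : ∀ {σ τ : Equiv.Perm T}, σ ^ 2 = 1 → τ ^ 2 = 1 → (σ * τ)⁻¹ = τ * σ := by
    intro σ τ hσ hτ
    rw [inv_eq_iff_mul_eq_one, show σ * τ * (τ * σ) = σ * τ ^ 2 * σ by
      simp only [sq, mul_assoc], hτ, mul_one, ← sq, hσ]
  have hle : ∀ s : Set (Equiv.Perm T), (α * β ∈ s ∨ β * α ∈ s) → (α * γ ∈ s ∨ γ * α ∈ s) →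
      Subgroup.closure {α * β, α * γ} ≤ Subgroup.closure s := by
    intro s h1 h2
    rw [Subgroup.closure_le]
    rintro _ (rfl | rfl)
    · rcases h1 with h | h
      · exact Subgroup.subset_closure h
      · rw [← inv hβ hα]
        exact inv_mem (Subgroup.subset_closure h)
    · rcases h2 with h | h
      · exact Subgroup.subset_closure h
      · rw [← inv hγ hα]
        exact inv_mem (Subgroup.subset_closure h)
  have hcases : (p = a ∧ q = b ∧ r = c) ∨ (p = a ∧ q = c ∧ r = b) ∨ (p = b ∧ q = a ∧ r = c) ∨
      (p = b ∧ q = c ∧ r = a) ∨ (p = c ∧ q = a ∧ r = b) ∨ (p = c ∧ q = b ∧ r = a) := by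
    rcases eq_of_perm_three habc with h | h | h | h | h | h <;> simp [h]
  -- Each ordering of the periods corresponds to a labelling of the three reflections; a product in
  -- the wrong order is the inverse of the required one.
  rcases hcases with ⟨rfl, rfl, rfl⟩ | ⟨rfl, rfl, rfl⟩ | ⟨rfl, rfl, rfl⟩ | ⟨rfl, rfl, rfl⟩ |
    ⟨rfl, rfl, rfl⟩ | ⟨rfl, rfl, rfl⟩
  · exact hR.isNormalizerQuotient γ β α hγ hβ hα (ab.swap hα hβ) ac (bc.swap hβ hγ)
      (hle _ (by simp) (by simp)) kγ kβ kα
  · exact hR.isNormalizerQuotient γ α β hγ hα hβ ab bc (ac.swap hα hγ)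
      (hle _ (by simp) (by simp)) kγ kα kβ
  · exact hR.isNormalizerQuotient β γ α hβ hγ hα (ac.swap hα hγ) ab bc
      (hle _ (by simp) (by simp)) kβ kγ kα
  · exact hR.isNormalizerQuotient β α γ hβ hα hγ ac (bc.swap hβ hγ) (ab.swap hα hβ)
      (hle _ (by simp) (by simp)) kβ kα kγ
  · exact hR.isNormalizerQuotient α γ β hα hγ hβ (bc.swap hβ hγ) (ab.swap hα hβ) ac
      (hle _ (by simp) (by simp)) kα kγ kβ
  · exact hR.isNormalizerQuotient α β γ hα hβ hγ bc (ac.swap hα hγ) ab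
      (hle _ (by simp) (by simp)) kα kβ kγ

end Realisation

theorem proposition8p1 (p q r : ℕ∞) (hp : p ≠ 0) (hq : q ≠ 0) (hr : r ≠ 0)
    (a b c : ℕ∞) (habc : [a, b, c].Perm [p, q, r])
    (ha : 2 ∣ a) (hb : 3 ∣ b) (hc : 7 ≤ c) :
    (Realisation.GroupCARP.{u} (Realisation.TriangleGroup p q r) ∧
      Realisation.GroupCARP.{u} (Realisation.ExtTriangleGroup p q r)) ∧
    (Realisation.CategoryCARP.{u} (Realisation.OrientedHypermap.{v} p q r)
        Realisation.OrientedHypermap.IsConn ∧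
      Realisation.CategoryCARP.{u} (Realisation.Hypermap.{v} p q r)
        Realisation.Hypermap.IsConn) ∧
    (Realisation.PermutationalCARP.{u, v, w, w'} (Realisation.TriangleGroup p q r) ∧
      Realisation.PermutationalCARP.{u, v, w, w'} (Realisation.ExtTriangleGroup p q r)) := by
  have h₁ : Realisation.GroupCARP.{u} (Realisation.TriangleGroup p q r) := fun A _ _ =>
    (Realisation.isNormalizerQuotient_triangleGroup A p q r a b c habc ha hb hc).1
  have h₂ : Realisation.GroupCARP.{u} (Realisation.ExtTriangleGroup p q r) := fun A _ _ =>
    (Realisation.isNormalizerQuotient_triangleGroup A p q r a b c habc ha hb hc).2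
  exact ⟨⟨h₁, h₂⟩, ⟨h₁.orientedHypermap, h₂.hypermap⟩,
    ⟨h₁.permutationalCARP, h₂.permutationalCARP⟩⟩
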